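/- Let $\Omega\subset\mathbb R^3$ be a bounded open set, let $\mu,\alpha>0$ and $1\le\beta\le 3$. Let $\mathcal V$ be the set of divergence-free fields in $(C_0^\infty(\Omega))^3$, and let $H$ and $V$ be the closures of $\mathcal V$ in $(L^2(\Omega))^3$ and $(H^1_0(\Omega))^3$. Write $(\cdot,\cdot)$, $|\cdot|$ for the inner product and norm of $(L^2(\Omega))^3$, $((u,v))=\sum_{i,j}\int_\Omega\partial_iu_j\,\partial_iv_j\,dx$, $\|u\|^2=((u,u))$ on $V$, $\langle\cdot,\cdot\rangle$ for the duality between $V'$ and $V$ (with $H\subset V'$ via $h\mapsto(h,\cdot)$), $b(u,v,w)=\sum_{i,j}\int_\Omega u_i\,\partial_iv_j\,w_j\,dx$, and, for $N>0$, $F_N(r)=\min(1,N/r)$ for $r>0$, $F_N(0)=1$. For $N>0$, $\tau<T$, $f\in L^2(\tau,T;V')$ and $u_\tau\in H$, a weak solution on $[\tau,T]$ of the globally modified Navier–Stokes equations with damping (GMNSED) with data $N,u_\tau,f$ is a function $u\in L^\infty(\tau,T;H)\cap L^2(\tau,T;V)$, identified with its weakly continuous representative $u\in C([\tau,T];H_w)$,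 with $F_N(\|u\|^{\beta-1})u\in L^{\beta+1}(\tau,T;(L^{\beta+1}(\Omega))^3)$, $u(\tau)=u_\tau$, and $$\frac{d}{dt}(u,w)+\mu((u,w))+F_N(\|u\|)\,b(u,u,w)+\alpha F_N(\|u\|^{\beta-1})\int_\Omega|u|^{\beta-1}u\cdot w\,dx=\langle f,w\rangle$$ in the sense of scalar distributions on $(\tau,T)$, for every $w\in V\cap(L^{\beta+1}(\Omega))^3$. Then weak solutions depend continuously on $N$, $u_\tau$ and $f$. More precisely: (i) There are a constant $C>0$, depending only on $\Omega,\mu,\alpha,\beta$, and constants $\gamma(M,N)>0$, depending only on these and on $M,N>0$, such that for all $M,N>0$ and $\tau<T$, if $u$ and $v$ are weak solutions on $[\tau,T]$ with data $N,u_\tau,f_u$ and $M,v_\tau,f_v$ respectively, and $f_v-f_u\in L^2(\tau,T;H)$, then for all $t\in[\tau,T]$ $$|v(t)-u(t)|^2\le Ce^{\gamma(M,N)(t-\tau)}\Big(|v_\tau-u_\tau|^2+\Big(\int_\tau^t\|u(s)\|^2ds\Big)|M-N|^2+\int_\tau^t|f_v(s)-f_u(s)|^2ds\Big).$$ (ii)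 Let $u$ be a weak solution on $[\tau,T]$ with data $N,u_\tau,f_u$. For every $\varepsilon>0$ there is $\delta>0$ such that every weak solution $v$ on $[\tau,T]$ with data $M,v_\tau,f_v$, where $M>0$, $|M-N|<\delta$, $|v_\tau-u_\tau|<\delta$, $f_v-f_u\in L^2(\tau,T;H)$ and $\int_\tau^T|f_v-f_u|^2ds<\delta$, satisfies $|v(t)-u(t)|<\varepsilon$ for all $t\in[\tau,T]$. -/

import Mathlib

open MeasureTheory Set
open scoped ContDiff RealInnerProductSpace

noncomputable section

namespace GMNSED

/-- Physical space `ℝ³` with the Euclidean norm. -/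
abbrev E3 : Type := EuclideanSpace ℝ (Fin 3)

/-- `3 × 3` matrices with the Hilbert-Schmidt inner product; the entry `(i, j)` of a gradient
is `∂ᵢ uⱼ`. -/
abbrev Mat3 : Type := EuclideanSpace ℝ (Fin 3 × Fin 3)

/-- `(L²(Ω))³`. -/
abbrev L2 (Ω : Set E3) : Type := Lp E3 2 (volume.restrict Ω)

/-- `(L²(Ω))^{3 × 3}`. -/
abbrev L2Mat (Ω : Set E3) : Type := Lp Mat3 2 (volume.restrict Ω)

/-- The classical gradient, with entries `∂ᵢ φⱼ`. -/
def grad (φ : E3 → E3) (x : E3) : Mat3 :=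
  WithLp.toLp 2 fun p => fderiv ℝ φ x (EuclideanSpace.single p.1 (1 : ℝ)) p.2

/-- The class `𝒱` of smooth divergence-free vector fields with compact support in `Ω`. -/
structure IsSolenoidalTest (Ω : Set E3) (φ : E3 → E3) : Prop where
  smooth : ContDiff ℝ ∞ φ
  compact_support : HasCompactSupport φ
  support_subset : tsupport φ ⊆ Ω
  div_free : ∀ x, ∑ i, grad φ x (i, i) = 0

/-- `H`, the closure of `𝒱` in `(L²(Ω))³`. -/
def H (Ω : Set E3) : Submodule ℝ (L2 Ω) :=
  (Submodule.span ℝ {p : L2 Ω | ∃ φ, IsSolenoidalTest Ω φ ∧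
    p =ᵐ[volume.restrict Ω] φ}).topologicalClosure

/-- `V`, the closure of `𝒱` in `(H¹₀(Ω))³`. An element of `V` is represented by the pair
`(u, ∇u)` in `(L²(Ω))³ × (L²(Ω))^{3 × 3}`, and the norm of the pair is the full `H¹` norm. -/
def V (Ω : Set E3) : Submodule ℝ (WithLp 2 (L2 Ω × L2Mat Ω)) :=
  (Submodule.span ℝ {p : WithLp 2 (L2 Ω × L2Mat Ω) | ∃ φ, IsSolenoidalTest Ω φ ∧
    p.fst =ᵐ[volume.restrict Ω] φ ∧ p.snd =ᵐ[volume.restrict Ω] grad φ}).topologicalClosure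

variable {Ω : Set E3}

/-- The field `u` underlying an element of `V`. -/
def fieldV (U : V Ω) : L2 Ω := (U : WithLp 2 (L2 Ω × L2Mat Ω)).fst

/-- The gradient of an element of `V`. -/
def gradV (U : V Ω) : L2Mat Ω := (U : WithLp 2 (L2 Ω × L2Mat Ω)).snd

/-- The second component of an element of `V` is the weak gradient of the first one. -/
theorem weak_grad (U : V Ω) (ψ : E3 → ℝ) (hψ : ContDiff ℝ ∞ ψ)
    (hc : HasCompactSupport ψ) (hs : tsupport ψ ⊆ Ω) (i j : Fin 3) :
    ∫ x in Ω, ψ x * gradV U x (i, j)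
      = -∫ x in Ω, fderiv ℝ ψ x (EuclideanSpace.single i (1 : ℝ)) * fieldV U x j := by
  have hd : Continuous fun x => fderiv ℝ ψ x (EuclideanSpace.single i (1 : ℝ)) :=
    (hψ.continuous_fderiv (by simp)).clm_apply continuous_const
  have hdc : HasCompactSupport fun x => fderiv ℝ ψ x (EuclideanSpace.single i (1 : ℝ)) :=
    hc.fderiv_apply (𝕜 := ℝ) _
  have hA : MemLp (fun x => EuclideanSpace.single (i, j) (ψ x) : E3 → Mat3) 2
      (volume.restrict Ω) := by
    refine (Continuous.memLp_of_hasCompactSupport ?_ ?_)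
    · have := hψ.continuous
      refine (PiLp.continuous_toLp 2 _).comp (continuous_pi fun k => ?_)
      by_cases h : k = (i, j)
      · subst h; simpa using this
      · simpa [h] using continuous_const
    · exact hc.comp_left (g := fun r => (EuclideanSpace.single (i, j) r : Mat3)) (by simp)
  have hB : MemLp (fun x => EuclideanSpace.single j
      (fderiv ℝ ψ x (EuclideanSpace.single i (1 : ℝ))) : E3 → E3) 2
      (volume.restrict Ω) := by
    refine (Continuous.memLp_of_hasCompactSupport ?_ ?_)
    · refine (PiLp.continuous_toLp 2 _).comp (continuous_pi fun k => ?_)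
      by_cases h : k = j
      · subst h; simpa using hd
      · simpa [h] using continuous_const
    · exact hdc.comp_left (g := fun r => (EuclideanSpace.single j r : E3)) (by simp)
  let L : WithLp 2 (L2 Ω × L2Mat Ω) →L[ℝ] ℝ :=
    (innerSL ℝ hA.toLp).comp (WithLp.sndL 2 ℝ (L2 Ω) (L2Mat Ω))
      + (innerSL ℝ hB.toLp).comp (WithLp.fstL 2 ℝ (L2 Ω) (L2Mat Ω))
  have hL : ∀ p : WithLp 2 (L2 Ω × L2Mat Ω), L p = (∫ x in Ω, ψ x * p.snd x (i, j))
      + ∫ x in Ω, fderiv ℝ ψ x (EuclideanSpace.single i (1 : ℝ)) * p.fst x j := by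
    intro p
    simp only [L, add_apply, ContinuousLinearMap.comp_apply, innerSL_apply_apply,
      L2.inner_def]
    congr 1
    · refine integral_congr_ae ?_
      filter_upwards [hA.coeFn_toLp] with x hx
      rw [hx]; simp [EuclideanSpace.inner_single_left]
    · refine integral_congr_ae ?_
      filter_upwards [hB.coeFn_toLp] with x hx
      rw [hx]; simp [EuclideanSpace.inner_single_left]
  have key : L (U : WithLp 2 (L2 Ω × L2Mat Ω)) = 0 := by
    have : V Ω ≤ LinearMap.ker (L : WithLp 2 (L2 Ω × L2Mat Ω) →ₗ[ℝ] ℝ) := by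
      refine Submodule.topologicalClosure_minimal _ (Submodule.span_le.2 ?_)
        (ContinuousLinearMap.isClosed_ker L)
      rintro p ⟨φ, hφ, h1, h2⟩
      show L p = 0
      rw [hL]
      have e1 : ∫ x in Ω, ψ x * p.snd x (i, j) = ∫ x, ψ x * grad φ x (i, j) := by
        rw [← setIntegral_eq_integral_of_forall_compl_eq_zero (s := Ω)
          (f := fun x => ψ x * grad φ x (i, j))]
        · refine integral_congr_ae ?_
          filter_upwards [h2] with x hx
          rw [hx]
        · intro x hx
          rw [image_eq_zero_of_notMem_tsupport fun h => hx (hs h), zero_mul]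
      have e2 : ∫ x in Ω, fderiv ℝ ψ x (EuclideanSpace.single i (1 : ℝ)) * p.fst x j
          = ∫ x, fderiv ℝ ψ x (EuclideanSpace.single i (1 : ℝ)) * φ x j := by
        rw [← setIntegral_eq_integral_of_forall_compl_eq_zero (s := Ω)
          (f := fun x => fderiv ℝ ψ x (EuclideanSpace.single i (1 : ℝ)) * φ x j)]
        · refine integral_congr_ae ?_
          filter_upwards [h1] with x hx
          rw [hx]
        · intro x hx
          rw [image_eq_zero_of_notMem_tsupport fun h => hx (hφ.support_subset h)]; simp
      have hφj : ContDiff ℝ ∞ fun x => φ x j := (contDiff_euclidean.1 hφ.smooth) j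
      have e3 : ∀ x, grad φ x (i, j)
          = fderiv ℝ (fun x => φ x j) x (EuclideanSpace.single i (1 : ℝ)) := by
        intro x
        have hdφ : HasFDerivAt φ (fderiv ℝ φ x) x :=
          (hφ.smooth.differentiable (by simp) x).hasFDerivAt
        have := (PiLp.proj (𝕜 := ℝ) 2 (fun _ : Fin 3 => ℝ) j).hasFDerivAt.comp x hdφ
        have h' : fderiv ℝ (fun x => φ x j) x = _ := this.fderiv
        rw [h']; simp [grad]
      have hj : Continuous fun x =>
          fderiv ℝ (fun x => φ x j) x (EuclideanSpace.single i (1 : ℝ)) :=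
        (hφj.continuous_fderiv (by simp)).clm_apply continuous_const
      rw [e1, e2]
      simp_rw [e3]
      rw [integral_mul_fderiv_eq_neg_fderiv_mul_of_integrable, neg_add_cancel]
      · exact (hd.mul hφj.continuous).integrable_of_hasCompactSupport hdc.mul_right
      · exact (hψ.continuous.mul hj).integrable_of_hasCompactSupport hc.mul_right
      · exact (hψ.continuous.mul hφj.continuous).integrable_of_hasCompactSupport hc.mul_right
      · exact fun x _ => hψ.differentiable (by simp) x
      · exact fun x _ => hφj.differentiable (by simp) x
    exact this U.2
  rw [hL] at key
  exact eq_neg_of_add_eq_zero_left key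

/-- An element of `V` is determined by its underlying field. -/
theorem fieldV_injective (hΩ : IsOpen Ω) :
    Function.Injective (fieldV : V Ω → L2 Ω) := by
  intro U W h
  have h2 : gradV U = gradV W := by
    have hp : ∀ p : Fin 3 × Fin 3, ∀ᵐ x ∂volume.restrict Ω, gradV (U - W) x p = 0 := by
      rintro ⟨i, j⟩
      have hm : MemLp (fun x => gradV (U - W) x (i, j)) 2 (volume.restrict Ω) :=
        (memLp_piLp_iff.1 (Lp.memLp (gradV (U - W)))) (i, j)
      have hz : ∀ᵐ x ∂(volume : Measure E3), x ∈ Ω → gradV (U - W) x (i, j) = 0 := by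
        refine hΩ.ae_eq_zero_of_integral_contDiff_smul_eq_zero
          (locallyIntegrableOn_of_locallyIntegrable_restrict
            (hm.locallyIntegrable (by norm_num))) ?_
        intro ψ hψ hc hs
        rw [← setIntegral_eq_integral_of_forall_compl_eq_zero (s := Ω)]
        · simp only [smul_eq_mul]
          rw [weak_grad (U - W) ψ hψ hc hs i j, neg_eq_zero]
          have h0 : fieldV (U - W) = 0 := sub_eq_zero.2 h
          rw [h0]
          refine integral_eq_zero_of_ae ?_
          filter_upwards [Lp.coeFn_zero E3 2 (volume.restrict Ω)] with x hx
          rw [hx]; simp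
        · intro x hx
          rw [image_eq_zero_of_notMem_tsupport fun h => hx (hs h), zero_smul]
      exact (ae_restrict_iff' hΩ.measurableSet).2 hz
    have h0 : gradV (U - W) = 0 := by
      refine Lp.ext ?_
      filter_upwards [ae_all_iff.2 hp, Lp.coeFn_zero Mat3 2 (volume.restrict Ω)] with x hx h0
      rw [h0]; ext p; exact hx p
    exact sub_eq_zero.1 h0
  exact Subtype.ext (WithLp.ofLp_injective 2 (Prod.ext h h2))

/-- The inner product `((u, v)) = ∑ᵢⱼ ∫ ∂ᵢ uⱼ ∂ᵢ vⱼ` of `V`. -/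
def innerV (U W : V Ω) : ℝ := ⟪gradV U, gradV W⟫

/-- The norm `‖u‖ = |∇u|` of `V`. -/
def normV (U : V Ω) : ℝ := ‖gradV U‖

/-- The dual space `V'`; the norm is the one dual to the `H¹` norm. -/
abbrev VDual (Ω : Set E3) : Type := V Ω →L[ℝ] ℝ

/-- The embedding of `H` in `V'`: `h` acts as `w ↦ (h, w)`. -/
def toVDual (h : H Ω) : VDual Ω :=
  (innerSL ℝ (h : L2 Ω)).comp ((WithLp.fstL 2 ℝ (L2 Ω) (L2Mat Ω)).comp (V Ω).subtypeL)

/-- `x ∈ V` for an element `x` of `H`. -/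
def MemV (x : H Ω) : Prop := ∃ U : V Ω, fieldV U = (x : L2 Ω)

open Classical in
/-- An element of `H` that lies in `V`, regarded as an element of `V` (and `0` otherwise). -/
def toV (x : H Ω) : V Ω := if h : MemV x then h.choose else 0

/-- `b(u, v, w) = ∑ᵢⱼ ∫_Ω uᵢ ∂ᵢvⱼ wⱼ dx`. -/
def b (U W Z : V Ω) : ℝ :=
  ∫ x in Ω, ∑ i, ∑ j, fieldV U x i * gradV W x (i, j) * fieldV Z x j

/-- `∫_Ω |u|^{β - 1} u · w dx`. -/
def damping (β : ℝ) (U W : V Ω) : ℝ :=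
  ∫ x in Ω, ‖fieldV U x‖ ^ (β - 1) * ⟪fieldV U x, fieldV W x⟫

/-- The cutoff `F_N(r) = min(1, N / r)`, with the value `1` at `r = 0`. -/
def F (N r : ℝ) : ℝ := if r = 0 then 1 else min 1 (N / r)

/-- `u` is a weak solution on `[τ, T]` of the globally modified Navier-Stokes equations with
damping, with viscosity `μ`, damping parameters `α`, `β`, cutoff `N`, forcing `f` and initial
datum `u₀`. As usual, `u` stands for its weakly continuous representative, so that its values at
all times (in particular at `τ`) make sense. -/
structure IsWeakSolution (μ α β N τ T : ℝ) (f : ℝ → VDual Ω) (u₀ : H Ω) (u : ℝ → H Ω) :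
    Prop where
  /-- `f ∈ L²(τ, T; V')` -/
  forcing : MemLp f 2 (volume.restrict (Ioc τ T))
  /-- `u ∈ L^∞(τ, T; H)` -/
  memLp_top : MemLp u ⊤ (volume.restrict (Ioc τ T))
  /-- `u ∈ L²(τ, T; V)` -/
  memV : ∀ᵐ t ∂volume.restrict (Ioc τ T), MemV (u t)
  memLp_V : MemLp (fun t => toV (u t)) 2 (volume.restrict (Ioc τ T))
  /-- `F_N(‖u‖^{β-1}) u ∈ L^{β+1}(τ, T; (L^{β+1}(Ω))³)` -/
  memLp_damping : ∀ᵐ t ∂volume.restrict (Ioc τ T),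
    MemLp (fun x => F N (normV (toV (u t)) ^ (β - 1)) • (u t : L2 Ω) x)
      (ENNReal.ofReal (β + 1)) (volume.restrict Ω)
  lintegral_damping : ∫⁻ t in Ioc τ T,
    eLpNorm (fun x => F N (normV (toV (u t)) ^ (β - 1)) • (u t : L2 Ω) x)
      (ENNReal.ofReal (β + 1)) (volume.restrict Ω) ^ (β + 1) < ⊤
  /-- `u ∈ C([τ, T]; H_w)` -/
  weakly_continuous : ∀ h : H Ω, ContinuousOn (fun t => ⟪u t, h⟫) (Icc τ T)
  initial : u τ = u₀
  /-- For every `w ∈ V ∩ (L^{β+1}(Ω))³`, the equation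
  `d/dt (u,w) + μ((u,w)) + F_N(‖u‖) b(u,u,w) + α F_N(‖u‖^{β-1}) (|u|^{β-1}u, w) = ⟨f,w⟩`
  holds in the sense of scalar distributions on `(τ, T)`. -/
  equation : ∀ w : V Ω, MemLp (fieldV w) (ENNReal.ofReal (β + 1)) (volume.restrict Ω) →
    ∀ ψ : ℝ → ℝ, ContDiff ℝ ∞ ψ → HasCompactSupport ψ → tsupport ψ ⊆ Ioo τ T →
      -(∫ t in τ..T, ⟪(u t : L2 Ω), fieldV w⟫ * deriv ψ t)
        + ∫ t in τ..T,
            (μ * innerV (toV (u t)) w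
              + F N (normV (toV (u t))) * b (toV (u t)) (toV (u t)) w
              + α * (F N (normV (toV (u t)) ^ (β - 1)) * damping β (toV (u t)) w)) * ψ t
        = ∫ t in τ..T, f t w * ψ t

/-- The difference `f₂ - f₁` of two forcings is the element `g` of `L²(τ, T; H)`. -/
def ForcingDiff (τ T : ℝ) (f₁ f₂ : ℝ → VDual Ω) (g : ℝ → H Ω) : Prop :=
  MemLp g 2 (volume.restrict (Ioc τ T)) ∧
    ∀ᵐ t ∂volume.restrict (Ioc τ T), f₂ t - f₁ t = toVDual (g t)

end GMNSED

end

/-!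
As `β ≤ 3`, `V ⊂ L⁶` and `Ω` has finite volume, every term of the equation other than the time
derivative belongs to `L²(τ, T; V')`, and the equation can be tested with any element of `V`. The
difference `w = v - u` of two weak solutions thus has a time derivative in `L²(τ, T; V')` and
satisfies the energy inequality `|w(t)|² ≤ |w(τ)|² + 2 ∫ ⟨w', w⟩`. It follows, without any
regularization, from `|w(s)|² - |w(s - h)|² ≤ 2 ⟨w(s) - w(s - h), w(s)⟩`: integrated over `s`, the
right-hand side is the integral over `0 ≤ k ≤ h` of the correlation `k ↦ 2 ∫ ⟨w'(s - k), w(s)⟩ ds`,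
which is continuous at `k = 0`.

In `⟨w', w⟩` the viscosity provides `-μ‖w‖²`. The part of the convection that is left after
`b(u, w, w) = 0` is controlled by `‖F_M(‖v‖) v‖ ≤ M` and by the Lipschitz dependence of the cutoff
on its level and its argument; the damping is monotone up to a difference of cutoffs of the same
kind. Young's inequality absorbs all gradients of `w` into the viscosity, and Gronwall's lemma
concludes.
-/

namespace GMNSED

open Filter Topology

/-! ### Weak derivatives on an interval -/

/-- The class `C_c^∞((a, b))` of scalar test functions. -/
structure IsScalarTest (a b : ℝ) (ψ : ℝ → ℝ) : Prop where
  smooth : ContDiff ℝ ∞ ψ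
  compact_support : HasCompactSupport ψ
  support_subset : tsupport ψ ⊆ Ioo a b

/-- `k` is the derivative of `x` on `(a, b)` in the sense of scalar distributions. -/
def HasWeakDerivOn (x k : ℝ → ℝ) (a b : ℝ) : Prop :=
  ∀ ψ, IsScalarTest a b ψ → ∫ t in a..b, x t * deriv ψ t = -∫ t in a..b, k t * ψ t

namespace IsScalarTest

variable {a b : ℝ} {ψ : ℝ → ℝ}

theorem eq_zero_of_notMem (hψ : IsScalarTest a b ψ) {t : ℝ} (ht : t ∉ Ioo a b) : ψ t = 0 :=
  image_eq_zero_of_notMem_tsupport fun h => ht (hψ.support_subset h)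

theorem continuous_deriv (hψ : IsScalarTest a b ψ) : Continuous (deriv ψ) :=
  hψ.smooth.continuous_deriv (by simp)

theorem intervalIntegral_eq_integral (hψ : IsScalarTest a b ψ) (hab : a ≤ b) (y : ℝ → ℝ) :
    ∫ t in a..b, y t * ψ t = ∫ t, y t * ψ t := by
  rw [intervalIntegral.integral_of_le hab, setIntegral_eq_integral_of_forall_compl_eq_zero]
  intro t ht
  rw [hψ.eq_zero_of_notMem fun h => ht (Ioo_subset_Ioc_self h), mul_zero]

theorem sub_const_mul {ρ : ℝ → ℝ} (hψ : IsScalarTest a b ψ) (hρ : IsScalarTest a b ρ) (c : ℝ) :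
    IsScalarTest a b fun t => ψ t - c * ρ t where
  smooth := hψ.smooth.sub (contDiff_const.mul hρ.smooth)
  compact_support := hψ.compact_support.sub hρ.compact_support.mul_left
  support_subset := (tsupport_sub ψ fun t => c * ρ t).trans
    (union_subset hψ.support_subset (tsupport_mul_subset_right.trans hρ.support_subset))

theorem exists_deriv_eq (hψ : IsScalarTest a b ψ) (h0 : ∫ t in a..b, ψ t = 0) :
    ∃ Ψ, IsScalarTest a b Ψ ∧ deriv Ψ = ψ := by
  rcases eq_empty_or_nonempty (tsupport ψ) with he | hne
  · rw [tsupport_eq_empty_iff] at he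
    subst he
    exact ⟨0, hψ, by ext; simp⟩
  obtain ⟨c, hc, hcl⟩ := hψ.compact_support.exists_isLeast hne
  obtain ⟨d, hd, hdg⟩ := hψ.compact_support.exists_isGreatest hne
  have hi : ∀ s t, IntervalIntegrable ψ volume s t := fun s t =>
    hψ.smooth.continuous.intervalIntegrable s t
  have hderiv : deriv (fun t => ∫ s in a..t, ψ s) = ψ := by
    ext t
    exact hψ.smooth.continuous.deriv_integral ψ a t
  have hzero_of_forall : ∀ {s t : ℝ}, (∀ r ∈ uIoc s t, r ∉ tsupport ψ) → ∫ r in s..t, ψ r = 0 :=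
    fun h => intervalIntegral.integral_zero_ae
      (Eventually.of_forall fun r hr => image_eq_zero_of_notMem_tsupport (h r hr))
  have hsub : tsupport (fun t => ∫ s in a..t, ψ s) ⊆ Icc c d := by
    refine closure_minimal (fun t ht => ?_) isClosed_Icc
    by_contra hcd
    rw [mem_Icc, not_and_or, not_le, not_le] at hcd
    refine ht ?_
    rcases hcd with htc | hdt
    · refine hzero_of_forall fun r hr hrψ => (hcl hrψ).not_gt ?_
      exact hr.2.trans_lt (max_lt (hψ.support_subset hc).1 htc)
    · have htb : ∫ s in t..b, ψ s = 0 := hzero_of_forall fun r hr hrψ =>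
        (hdg hrψ).not_gt ((lt_min hdt (hψ.support_subset hd).2).trans hr.1)
      rw [← h0, ← intervalIntegral.integral_add_adjacent_intervals (hi a t) (hi t b), htb, add_zero]
  refine ⟨fun t => ∫ s in a..t, ψ s, ⟨?_, ?_, hsub.trans ?_⟩, hderiv⟩
  · refine contDiff_infty_iff_deriv.2 ⟨fun t => ?_, by rw [hderiv]; exact hψ.smooth⟩
    exact (hψ.smooth.continuous.integral_hasStrictDerivAt a t).hasDerivAt.differentiableAt
  · exact .of_support_subset_isCompact isCompact_Icc ((subset_tsupport _).trans hsub)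
  · exact Icc_subset_Ioo (hψ.support_subset hc).1 (hψ.support_subset hd).2

end IsScalarTest

theorem exists_isScalarTest_integral_eq_one {a b : ℝ} (hab : a < b) :
    ∃ ρ, IsScalarTest a b ρ ∧ ∫ t in a..b, ρ t = 1 := by
  let f : ContDiffBump ((a + b) / 2) := ⟨(b - a) / 8, (b - a) / 4, by linarith, by linarith⟩
  have hf : IsScalarTest a b (f.normed volume) := by
    refine ⟨f.contDiff_normed, f.hasCompactSupport_normed, ?_⟩
    rw [f.tsupport_normed_eq, Real.closedBall_eq_Icc]
    exact Icc_subset_Ioo (by simp only [f]; linarith) (by simp only [f]; linarith)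
  refine ⟨_, hf, ?_⟩
  simpa using (hf.intervalIntegral_eq_integral hab.le 1).trans (by simpa using f.integral_normed)

theorem eq_of_integral_mul_deriv_eq_zero {a b : ℝ} (hab : a < b) {y : ℝ → ℝ}
    (hy : ContinuousOn y (Icc a b))
    (h : ∀ ψ, IsScalarTest a b ψ → ∫ t in a..b, y t * deriv ψ t = 0)
    {s t : ℝ} (hs : s ∈ Icc a b) (ht : t ∈ Icc a b) : y s = y t := by
  obtain ⟨ρ, hρ, hρ1⟩ := exists_isScalarTest_integral_eq_one hab
  set c := ∫ t in a..b, y t * ρ t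
  have hyi : ∀ ψ : ℝ → ℝ, Continuous ψ → IntervalIntegrable (fun t => y t * ψ t) volume a b :=
    fun ψ hψ => (hy.mul hψ.continuousOn).intervalIntegrable_of_Icc hab.le
  have hyψ : ∀ ψ, IsScalarTest a b ψ → ∫ t in a..b, y t * ψ t = c * ∫ t in a..b, ψ t := by
    intro ψ hψ
    set m := ∫ t in a..b, ψ t
    obtain ⟨Ψ, hΨ, hΨd⟩ := (hψ.sub_const_mul hρ m).exists_deriv_eq (by
      rw [intervalIntegral.integral_sub (hψ.smooth.continuous.intervalIntegrable _ _)
        ((hρ.smooth.continuous.intervalIntegrable _ _).const_mul m),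
        intervalIntegral.integral_const_mul, hρ1, mul_one, sub_self])
    have h0 := h Ψ hΨ
    simp only [hΨd, mul_sub, mul_left_comm _ m] at h0
    rw [intervalIntegral.integral_sub (hyi ψ hψ.smooth.continuous)
      ((hyi ρ hρ.smooth.continuous).const_mul m), intervalIntegral.integral_const_mul] at h0
    rw [sub_eq_zero.1 h0, mul_comm]
  have hae : ∀ᵐ t, t ∈ Ioo a b → y t - c = 0 := by
    refine isOpen_Ioo.ae_eq_zero_of_integral_contDiff_smul_eq_zero
      (((hy.mono Ioo_subset_Icc_self).sub continuousOn_const).locallyIntegrableOn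
        measurableSet_Ioo) fun ψ hψ hψc hψs => ?_
    have hψ' : IsScalarTest a b ψ := ⟨hψ, hψc, hψs⟩
    simp only [smul_eq_mul, mul_comm (ψ _)]
    rw [← hψ'.intervalIntegral_eq_integral hab.le]
    simp only [sub_mul]
    rw [intervalIntegral.integral_sub (hyi ψ hψ.continuous)
      ((hψ.continuous.intervalIntegrable _ _).const_mul c), intervalIntegral.integral_const_mul,
      hyψ ψ hψ', sub_self]
  have heq : EqOn y (fun _ => c) (Icc a b) := by
    refine Measure.eqOn_Icc_of_ae_eq volume hab.ne ?_ hy continuousOn_const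
    rw [restrict_Ioo_eq_restrict_Icc.symm]
    filter_upwards [(ae_restrict_iff' measurableSet_Ioo).2 hae] with t ht using sub_eq_zero.1 ht
  rw [heq hs, heq ht]

theorem hasWeakDerivOn_integral {a b : ℝ} {k : ℝ → ℝ} (hk : IntervalIntegrable k volume a b) :
    HasWeakDerivOn (fun t => ∫ s in a..t, k s) k a b := by
  intro ψ hψ
  have hac := hk.absolutelyContinuousOnInterval_intervalIntegral (c := a) left_mem_uIcc
  have hψac : AbsolutelyContinuousOnInterval ψ a b :=
    (hψ.smooth.of_le (by simp)).contDiffOn.absolutelyContinuousOnInterval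
  rw [hac.integral_mul_deriv_eq_deriv_mul hψac, intervalIntegral.integral_same,
    hψ.eq_zero_of_notMem right_notMem_Ioo, mul_zero, zero_mul, sub_zero, zero_sub, neg_inj]
  refine intervalIntegral.integral_congr_ae ?_
  filter_upwards [hk.ae_hasDerivAt_integral] with t ht hmem
  rw [(ht (uIoc_subset_uIcc hmem) a left_mem_uIcc).deriv]

namespace HasWeakDerivOn

variable {a b : ℝ} {x x' k k' : ℝ → ℝ}

theorem sub (hx : HasWeakDerivOn x k a b) (hx' : HasWeakDerivOn x' k' a b) (hab : a ≤ b)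
    (hxc : ContinuousOn x (Icc a b)) (hxc' : ContinuousOn x' (Icc a b))
    (hk : IntervalIntegrable k volume a b) (hk' : IntervalIntegrable k' volume a b) :
    HasWeakDerivOn (fun t => x t - x' t) (fun t => k t - k' t) a b := by
  intro ψ hψ
  simp only [sub_mul]
  have hxi : ∀ {y : ℝ → ℝ}, ContinuousOn y (Icc a b) →
      IntervalIntegrable (fun t => y t * deriv ψ t) volume a b := fun hy =>
    (hy.mul hψ.continuous_deriv.continuousOn).intervalIntegrable_of_Icc hab
  rw [intervalIntegral.integral_sub (hxi hxc) (hxi hxc'),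
    intervalIntegral.integral_sub (hk.mul_continuousOn hψ.smooth.continuous.continuousOn)
      (hk'.mul_continuousOn hψ.smooth.continuous.continuousOn), hx ψ hψ, hx' ψ hψ]
  ring

theorem sub_eq_integral (hx : HasWeakDerivOn x k a b) (hab : a < b)
    (hxc : ContinuousOn x (Icc a b)) (hk : IntervalIntegrable k volume a b)
    {s t : ℝ} (hs : s ∈ Icc a b) (ht : t ∈ Icc a b) : x t - x s = ∫ r in s..t, k r := by
  have hkc : ContinuousOn (fun t => ∫ r in a..t, k r) (Icc a b) := by
    simpa only [uIcc_of_le hab.le] using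
      intervalIntegral.continuousOn_primitive_interval' hk left_mem_uIcc
  have hki : ∀ r ∈ Icc a b, IntervalIntegrable k volume a r := fun r hr =>
    hk.mono_set (by rw [uIcc_of_le hab.le, uIcc_of_le hr.1]; exact Icc_subset_Icc_right hr.2)
  have hconst := eq_of_integral_mul_deriv_eq_zero hab (hxc.sub hkc) (fun ψ hψ => by
    simpa using hx.sub (hasWeakDerivOn_integral hk) hab.le hxc hkc hk hk ψ hψ) hs ht
  rw [← intervalIntegral.integral_interval_sub_left (hki t ht) (hki s hs)]
  simp only [Pi.sub_apply] at hconst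
  linarith

end HasWeakDerivOn

theorem le_mul_exp_of_le_add_integral {a b A c : ℝ} (hab : a ≤ b) (hc : 0 ≤ c) {φ : ℝ → ℝ}
    (hφ : IntervalIntegrable φ volume a b)
    (h : ∀ t ∈ Icc a b, φ t ≤ A + c * ∫ s in a..t, φ s) :
    φ b ≤ A * Real.exp (c * (b - a)) := by
  set Y : ℝ → ℝ := fun t => A + c * ∫ s in a..t, φ s
  set E : ℝ → ℝ := fun t => Real.exp (-(c * (t - a)))
  have hE : ContDiff ℝ 1 E := by fun_prop
  have hEd : ∀ t, deriv E t = -c * E t := fun t => by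
    have h1 : HasDerivAt (fun t => -(c * (t - a))) (-(c * 1)) t :=
      (((hasDerivAt_id t).sub_const a).const_mul c).neg
    rw [h1.exp.deriv, mul_one, mul_comm]
  have hY : AbsolutelyContinuousOnInterval Y a b :=
    contDiff_const.contDiffOn.absolutelyContinuousOnInterval.add
      ((hφ.absolutelyContinuousOnInterval_intervalIntegral left_mem_uIcc).const_mul c)
  have hYd : ∀ᵐ t, t ∈ uIcc a b → deriv Y t = c * φ t := by
    filter_upwards [hφ.ae_hasDerivAt_integral] with t ht hmem
    exact (((ht hmem a left_mem_uIcc).const_mul c).const_add A).deriv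
  have hle : E b * Y b - E a * Y a ≤ 0 := by
    rw [← hE.contDiffOn.absolutelyContinuousOnInterval.integral_deriv_mul_eq_sub hY]
    rw [intervalIntegral.integral_of_le hab]
    refine integral_nonpos_of_ae ((ae_restrict_iff' measurableSet_Ioc).2 ?_)
    filter_upwards [hYd] with t hYt ht
    have htI : t ∈ Icc a b := Ioc_subset_Icc_self ht
    rw [hEd, hYt (by rwa [uIcc_of_le hab])]
    have hφY : c * E t * (φ t - Y t) ≤ 0 :=
      mul_nonpos_of_nonneg_of_nonpos (by positivity) (sub_nonpos.2 (h t htI))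
    simp only [Pi.zero_apply]
    linarith
  have hYb : E b * Y b ≤ A := by simpa [E, Y] using hle
  calc φ b ≤ Y b := h b (right_mem_Icc.2 hab)
    _ = E b * Y b * Real.exp (c * (b - a)) := by
      rw [mul_right_comm, ← Real.exp_add, neg_add_cancel, Real.exp_zero, one_mul]
    _ ≤ A * Real.exp (c * (b - a)) := by gcongr

/-! ### The energy inequality -/

section Energy

variable {E X : Type*} [NormedAddCommGroup E] [NormedAddCommGroup X] [NormedSpace ℝ X]
  {G : ℝ → X →L[ℝ] ℝ} {W : ℝ → X} {w : ℝ → E} {a b h : ℝ}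

/-- The correlation `k ↦ ∫ ⟨G(s - k), W(s)⟩ ds` of a dual-valued function `G` and a function `W`;
its value at `0` is the work of `G` along `W`. -/
noncomputable def correlation (G : ℝ → X →L[ℝ] ℝ) (W : ℝ → X) (k : ℝ) : ℝ := ∫ s, G (s - k) (W s)

theorem continuous_correlation (hG : MemLp G 2) (hW : MemLp W 2) :
    Continuous (correlation G W) := by
  let Q := (ContinuousLinearMap.id ℝ (X →L[ℝ] ℝ)).lpPairing (volume : Measure ℝ) 2 2
  have hQ : correlation G W = fun k => Q (DomAddAct.mk (-k : ℝ) +ᵥ hG.toLp G) (hW.toLp W) := by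
    ext k
    rw [ContinuousLinearMap.lpPairing_eq_integral, DomAddAct.mk_vadd_toLp]
    refine integral_congr_ae ?_
    filter_upwards [hW.coeFn_toLp, MemLp.coeFn_toLp
      (hG.comp_measurePreserving (measurePreserving_vadd (-k) volume))] with s hWs hGs
    rw [hWs]
    exact congrArg (fun A : X →L[ℝ] ℝ => A (W s)) (hGs.trans (by simp [sub_eq_neg_add])).symm
  have h2 : Fact ((2 : ENNReal) ≠ ⊤) := ⟨by simp⟩
  have hshift : Continuous fun k : ℝ => DomAddAct.mk (-k) +ᵥ hG.toLp G :=
    (DomAddAct.continuous_mk.comp continuous_neg).vadd continuous_const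
  rw [hQ]
  exact (Q.continuous.comp hshift).clm_apply continuous_const

theorem integrable_prod_apply_sub (hG : Integrable G) (hW : Integrable W) :
    Integrable (fun p : ℝ × ℝ => G (p.2 - p.1) (W p.2)) (volume.prod volume) := by
  simpa using hW.convolution_integrand (μ := volume) (ν := volume)
    (ContinuousLinearMap.id ℝ (X →L[ℝ] ℝ)).flip hG.comp_neg

theorem integrable_integral_window (hG : Integrable G) (hW : Integrable W) (hh : 0 ≤ h) :
    Integrable fun s => ∫ r in s - h..s, G r (W s) := by
  have hprod := ((integrable_prod_apply_sub hG hW).mono_measure (Measure.prod_mono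
    (Measure.restrict_le_self (s := Ioc 0 h)) le_rfl)).integral_prod_right
  refine hprod.congr (Eventually.of_forall fun s => ?_)
  simpa [intervalIntegral.integral_of_le hh] using
    intervalIntegral.integral_comp_sub_left (a := 0) (b := h) (fun r => G r (W s)) s

theorem integral_correlation (hG : Integrable G) (hW : Integrable W) (hh : 0 ≤ h) :
    ∫ k in 0..h, correlation G W k = ∫ s, ∫ r in s - h..s, G r (W s) := by
  simp only [correlation, intervalIntegral.integral_of_le hh]
  rw [integral_integral_swap ((integrable_prod_apply_sub hG hW).mono_measure
    (Measure.prod_mono Measure.restrict_le_self le_rfl))]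
  refine integral_congr_ae (Eventually.of_forall fun s => ?_)
  simpa [intervalIntegral.integral_of_le hh] using
    intervalIntegral.integral_comp_sub_left (a := 0) (b := h) (fun r => G r (W s)) s

theorem intervalIntegrable_of_eq_const_left {e : ℝ → ℝ} {e₀ : ℝ} (hab : a ≤ b)
    (he : IntervalIntegrable e volume a b) (h₀ : ∀ s ≤ a, e s = e₀) {c d : ℝ}
    (hc : c ≤ b) (hd : d ≤ b) : IntervalIntegrable e volume c d := by
  have hleft : ∀ c, IntervalIntegrable e volume (min c a) a := fun c =>
    (intervalIntegrable_const (c := e₀)).congr fun s hs =>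
      (h₀ s (by rw [uIoc_of_le (min_le_right c a)] at hs; exact hs.2)).symm
  have hb : ∀ c ≤ b, IntervalIntegrable e volume c b := fun c hc =>
    ((hleft c).trans he).mono_set (by
      rw [uIcc_of_le hc, uIcc_of_le ((min_le_right c a).trans hab)]
      exact Icc_subset_Icc_left (min_le_left c a))
  exact (hb c hc).trans (hb d hd).symm

theorem integral_sub_comp_sub_right {e : ℝ → ℝ} {e₀ : ℝ} (hab : a ≤ b)
    (he : IntervalIntegrable e volume a b) (h₀ : ∀ s ≤ a, e s = e₀) (hh : 0 ≤ h) :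
    ∫ s in a..b, (e s - e (s - h)) = (∫ s in b - h..b, e s) - h * e₀ := by
  have hi : ∀ {c d : ℝ}, c ≤ b → d ≤ b → IntervalIntegrable e volume c d :=
    intervalIntegrable_of_eq_const_left hab he h₀
  have hconst : ∫ s in a - h..a, e s = h * e₀ := by
    rw [intervalIntegral.integral_congr (g := fun _ => e₀)]
    · simp
    · intro s hs
      rw [uIcc_of_le (by linarith)] at hs
      exact h₀ s hs.2
  rw [intervalIntegral.integral_sub he
      (by simpa using (hi (by linarith) (by linarith) :
        IntervalIntegrable e volume (a - h) (b - h)).comp_sub_right h),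
    intervalIntegral.integral_comp_sub_right e, ← hconst]
  linarith [intervalIntegral.integral_add_adjacent_intervals
      (hi (by linarith) hab : IntervalIntegrable e volume (a - h) a) he,
    intervalIntegral.integral_add_adjacent_intervals
      (hi (by linarith) (by linarith) : IntervalIntegrable e volume (a - h) (b - h))
      (hi (by linarith) le_rfl)]

theorem le_of_forall_integral_le {p q : ℝ → ℝ} {d : ℝ} (hd : 0 < d)
    (hp : ContinuousOn p (Icc 0 d)) (hq : ContinuousOn q (Icc 0 d))
    (hpq : ∀ h ∈ Ioo 0 d, ∫ k in 0..h, p k ≤ ∫ k in 0..h, q k) : p 0 ≤ q 0 := by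
  by_contra! hlt
  have h0 : (0 : ℝ) ∈ Icc 0 d := left_mem_Icc.2 hd.le
  have hev : ∀ᶠ k in 𝓝[≥] 0, q k < p k := by
    rw [← nhdsWithin_Icc_eq_nhdsGE hd]
    exact (hq 0 h0).eventually_lt (hp 0 h0) hlt
  obtain ⟨c, hc, hball⟩ := (mem_nhdsGE_iff_exists_mem_Ioc_Ico_subset hd).1 hev
  have hh : c / 2 ∈ Ioo 0 d := ⟨half_pos hc.1, (half_lt_self hc.1).trans_le hc.2⟩
  have hsub : Icc 0 (c / 2) ⊆ Icc 0 d := Icc_subset_Icc_right hh.2.le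
  refine (hpq _ hh).not_gt (intervalIntegral.integral_lt_integral_of_continuousOn_of_le_of_exists_lt
    hh.1 (hq.mono hsub) (hp.mono hsub) (fun k hk => (hball ⟨hk.1.le, ?_⟩).le)
    ⟨0, left_mem_Icc.2 hh.1.le, hlt⟩)
  exact hk.2.trans_lt (half_lt_self hc.1)

/-- The energy `‖w‖²`, continued to the left of `a` by its value at `a`. With the continuation by
zero the energy inequality would need the energies just after `a` to be close to the one at `a`,
whereas weak continuity bounds them only from below. -/
noncomputable def clampedEnergy (w : ℝ → E) (a s : ℝ) : ℝ := ‖w (max s a)‖ ^ 2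

theorem clampedEnergy_of_ge {s : ℝ} (hs : a ≤ s) : clampedEnergy w a s = ‖w s‖ ^ 2 := by
  rw [clampedEnergy, max_eq_left hs]

theorem clampedEnergy_of_le {s : ℝ} (hs : s ≤ a) : clampedEnergy w a s = ‖w a‖ ^ 2 := by
  rw [clampedEnergy, max_eq_right hs]

theorem intervalIntegrable_clampedEnergy (hab : a ≤ b)
    (hw : MemLp w 2 (volume.restrict (Ioc a b))) {c d : ℝ} (hc : c ≤ b) (hd : d ≤ b) :
    IntervalIntegrable (clampedEnergy w a) volume c d := by
  refine intervalIntegrable_of_eq_const_left hab ?_ (fun s => clampedEnergy_of_le (w := w)) hc hd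
  rw [intervalIntegrable_iff_integrableOn_Ioc_of_le hab]
  exact (hw.integrable_norm_pow two_ne_zero).congr
    ((ae_restrict_mem measurableSet_Ioc).mono fun s hs => (clampedEnergy_of_ge hs.1.le).symm)

variable [InnerProductSpace ℝ E] {J : X →L[ℝ] E}

theorem two_mul_inner_sub_norm_sq_le (x y : E) : 2 * ⟪x, y⟫ - ‖y‖ ^ 2 ≤ ‖x‖ ^ 2 := by
  linarith [norm_sub_sq_real x y, sq_nonneg ‖x - y‖]

theorem integral_inner_le_integral_clampedEnergy (hh : h ∈ Ioo 0 (b - a))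
    (hwc : ContinuousOn (fun t => ⟪w t, w b⟫) (Icc a b))
    (hw : MemLp w 2 (volume.restrict (Ioc a b))) :
    ∫ s in b - h..b, (2 * ⟪w s, w b⟫ - ‖w b‖ ^ 2) ≤ ∫ s in b - h..b, clampedEnergy w a s := by
  have hbh : b - h ≤ b := by linarith [hh.1]
  have hsub : Icc (b - h) b ⊆ Icc a b := Icc_subset_Icc_left (by linarith [hh.2])
  refine intervalIntegral.integral_mono_on hbh (ContinuousOn.intervalIntegrable_of_Icc hbh ?_)
    (intervalIntegrable_clampedEnergy (by linarith [hh.1, hh.2]) hw hbh le_rfl) fun s hs => ?_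
  · exact (continuousOn_const.mul (hwc.mono hsub)).sub continuousOn_const
  · rw [clampedEnergy_of_ge (hsub hs).1]
    exact two_mul_inner_sub_norm_sq_le (w s) (w b)

theorem inner_sub_clamp_eq_integral
    (hwG : ∀ φ : X, ∀ s ∈ Icc a b, ∀ t ∈ Icc a b, ⟪w t - w s, J φ⟫ = ∫ r in s..t, G r φ)
    (φ : X) {s t : ℝ} (hst : s ≤ t) (hat : a ≤ t) (htb : t ≤ b) :
    ⟪w t - w (max s a), J φ⟫ = ∫ r in s..t, (Ioc a b).indicator G r φ := by
  have hmax : max s a ≤ t := max_le hst hat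
  rw [hwG φ _ ⟨le_max_right s a, hmax.trans htb⟩ t ⟨hat, htb⟩,
    intervalIntegral.integral_of_le hst, intervalIntegral.integral_of_le hmax,
    ← Ioc_inter_Ioi, ← setIntegral_indicator measurableSet_Ioi]
  refine setIntegral_congr_fun measurableSet_Ioc fun r hr => ?_
  by_cases har : a < r
  · simp [har, hr.2.trans htb]
  · simp [har]

theorem clampedEnergy_sub_le
    (hwG : ∀ φ : X, ∀ s ∈ Icc a b, ∀ t ∈ Icc a b, ⟪w t - w s, J φ⟫ = ∫ r in s..t, G r φ)
    (hh : 0 ≤ h) {s : ℝ} (hs : s ∈ Ioc a b) {φ : X} (hφ : J φ = w s) :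
    clampedEnergy w a s - clampedEnergy w a (s - h) ≤
      2 * ∫ r in s - h..s, (Ioc a b).indicator G r φ := by
  rw [← inner_sub_clamp_eq_integral hwG φ (by linarith) hs.1.le hs.2, hφ,
    clampedEnergy_of_ge hs.1.le, inner_sub_left, real_inner_self_eq_norm_sq, clampedEnergy]
  linarith [two_mul_inner_sub_norm_sq_le (w (max (s - h) a)) (w s)]

theorem integral_clampedEnergy_sub_le (hab : a ≤ b) (hh : 0 ≤ h)
    (hW : MemLp W 2 (volume.restrict (Ioc a b))) (hG : MemLp G 2 (volume.restrict (Ioc a b)))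
    (hJ : ∀ᵐ t ∂volume.restrict (Ioc a b), J (W t) = w t)
    (hwG : ∀ φ : X, ∀ s ∈ Icc a b, ∀ t ∈ Icc a b, ⟪w t - w s, J φ⟫ = ∫ r in s..t, G r φ) :
    ∫ s in a..b, (clampedEnergy w a s - clampedEnergy w a (s - h)) ≤
      2 * ∫ k in 0..h, correlation ((Ioc a b).indicator G) ((Ioc a b).indicator W) k := by
  have hG1 : Integrable ((Ioc a b).indicator G) :=
    (integrable_indicator_iff (ε' := X →L[ℝ] ℝ) measurableSet_Ioc).2 (hG.integrable one_le_two)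
  have hW1 : Integrable ((Ioc a b).indicator W) :=
    IntegrableOn.integrable_indicator (hW.integrable one_le_two) measurableSet_Ioc
  have hi : ∀ {c d : ℝ}, c ≤ b → d ≤ b → IntervalIntegrable (clampedEnergy w a) volume c d :=
    intervalIntegrable_clampedEnergy hab ((memLp_congr_ae hJ).1 (J.comp_memLp' hW))
  have hshift : IntervalIntegrable (fun s => clampedEnergy w a (s - h)) volume a b := by
    simpa using (hi (c := a - h) (d := b - h) (by linarith) (by linarith)).comp_sub_right h
  rw [integral_correlation hG1 hW1 hh, ← setIntegral_eq_integral_of_forall_compl_eq_zero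
    (s := Ioc a b) (fun s hs => by simp [hs]), ← integral_const_mul,
    intervalIntegral.integral_of_le hab]
  refine setIntegral_mono_ae_restrict
    ((intervalIntegrable_iff_integrableOn_Ioc_of_le hab).1 ((hi hab le_rfl).sub hshift))
    ((integrable_integral_window hG1 hW1 hh).const_mul 2).integrableOn ?_
  filter_upwards [hJ, ae_restrict_mem measurableSet_Ioc] with s hs hsm
  rw [indicator_of_mem hsm]
  exact clampedEnergy_sub_le hwG hh hsm hs

theorem norm_sq_le_of_inner_sub_eq_integral (hab : a < b)
    (hw : ∀ e : E, ContinuousOn (fun t => ⟪w t, e⟫) (Icc a b))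
    (hW : MemLp W 2 (volume.restrict (Ioc a b))) (hG : MemLp G 2 (volume.restrict (Ioc a b)))
    (hJ : ∀ᵐ t ∂volume.restrict (Ioc a b), J (W t) = w t)
    (hwG : ∀ φ : X, ∀ s ∈ Icc a b, ∀ t ∈ Icc a b, ⟪w t - w s, J φ⟫ = ∫ r in s..t, G r φ) :
    ‖w b‖ ^ 2 ≤ ‖w a‖ ^ 2 + 2 * ∫ t in a..b, G t (W t) := by
  set Θ := correlation ((Ioc a b).indicator G) ((Ioc a b).indicator W)
  have hG2 : MemLp ((Ioc a b).indicator G) 2 :=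
    (memLp_indicator_iff_restrict (ε := X →L[ℝ] ℝ) measurableSet_Ioc).2 hG
  have hΘ : Continuous Θ := continuous_correlation hG2
    ((memLp_indicator_iff_restrict measurableSet_Ioc).2 hW)
  have hΘ0 : Θ 0 = ∫ t in a..b, G t (W t) := by
    rw [intervalIntegral.integral_of_le hab.le, ← integral_indicator measurableSet_Ioc]
    refine integral_congr_ae (Eventually.of_forall fun s => ?_)
    by_cases hs : s ∈ Ioc a b <;> simp [hs]
  have hp : ContinuousOn (fun k => 2 * ⟪w (b - k), w b⟫ - ‖w b‖ ^ 2) (Icc 0 (b - a)) := by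
    refine (continuousOn_const.mul ((hw (w b)).comp (by fun_prop) fun k hk => ?_)).sub
      continuousOn_const
    exact ⟨by linarith [hk.2], by linarith [hk.1]⟩
  have hq : ContinuousOn (fun k => ‖w a‖ ^ 2 + 2 * Θ k) (Icc 0 (b - a)) :=
    (continuous_const.add (hΘ.const_mul 2)).continuousOn
  have hlim := le_of_forall_integral_le (sub_pos.2 hab) hp hq fun h hh => by
    have hw2 : MemLp w 2 (volume.restrict (Ioc a b)) := (memLp_congr_ae hJ).1 (J.comp_memLp' hW)
    rw [intervalIntegral.integral_comp_sub_left (fun s => 2 * ⟪w s, w b⟫ - ‖w b‖ ^ 2), sub_zero,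
      intervalIntegral.integral_add (by simp) ((hΘ.const_mul 2).intervalIntegrable _ _),
      intervalIntegral.integral_const_mul, intervalIntegral.integral_const, sub_zero, smul_eq_mul]
    linarith [integral_inner_le_integral_clampedEnergy hh (hw (w b)) hw2,
      integral_sub_comp_sub_right hab.le (intervalIntegrable_clampedEnergy hab.le hw2 hab.le le_rfl)
        (fun s hs => clampedEnergy_of_le hs) hh.1.le,
      integral_clampedEnergy_sub_le hab.le hh.1.le hW hG hJ hwG]
  rw [sub_zero, real_inner_self_eq_norm_sq, hΘ0] at hlim
  linarith

theorem integrable_dual_apply {ν : Measure ℝ} (hG : MemLp G 2 ν) (hW : MemLp W 2 ν) :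
    Integrable (fun t => G t (W t)) ν :=
  memLp_one_iff_integrable.1 ((ContinuousLinearMap.id ℝ (X →L[ℝ] ℝ)).memLp_of_bilin 1 hG hW)

theorem intervalIntegrable_dual_apply (hab : a ≤ b) (hG : MemLp G 2 (volume.restrict (Ioc a b)))
    (φ : X) : IntervalIntegrable (fun t => G t φ) volume a b :=
  (intervalIntegrable_iff_integrableOn_Ioc_of_le hab).2 (integrable_dual_apply hG (memLp_const φ))

theorem energy_inequality (hab : a < b)
    (hw : ∀ e : E, ContinuousOn (fun t => ⟪w t, e⟫) (Icc a b))
    (hW : MemLp W 2 (volume.restrict (Ioc a b))) (hG : MemLp G 2 (volume.restrict (Ioc a b)))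
    (hJ : ∀ᵐ t ∂volume.restrict (Ioc a b), J (W t) = w t)
    (hwG : ∀ φ : X, HasWeakDerivOn (fun t => ⟪w t, J φ⟫) (fun t => G t φ) a b)
    {t : ℝ} (ht : t ∈ Icc a b) :
    ‖w t‖ ^ 2 ≤ ‖w a‖ ^ 2 + 2 * ∫ s in a..t, G s (W s) := by
  rcases ht.1.eq_or_lt with rfl | hat
  · simp
  have hIcc : Icc a t ⊆ Icc a b := Icc_subset_Icc_right ht.2
  have hmono : volume.restrict (Ioc a t) ≤ volume.restrict (Ioc a b) :=
    Measure.restrict_mono (Ioc_subset_Ioc_right ht.2) le_rfl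
  refine norm_sq_le_of_inner_sub_eq_integral hat (fun e => (hw e).mono hIcc)
    (hW.mono_measure hmono) (hG.mono_measure hmono) (ae_mono hmono hJ) fun φ s hs r hr => ?_
  rw [inner_sub_left]
  exact (hwG φ).sub_eq_integral hab (hw (J φ)) (intervalIntegrable_dual_apply hab.le hG φ)
    (hIcc hs) (hIcc hr)

end Energy

/-! ### Test fields and the spaces `V` and `H` -/

section Gradient

variable {ι κ : Type*} [Fintype ι] [Fintype κ]

/-- The outer product `(u ⊗ w)ᵢⱼ = uᵢ wⱼ`, with values in the matrices with the Hilbert-Schmidt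
norm; the integrand of `b(u, v, w)` is `⟪∇v, u ⊗ w⟫`. -/
noncomputable def outer :
    EuclideanSpace ℝ ι →L[ℝ] EuclideanSpace ℝ κ →L[ℝ] EuclideanSpace ℝ (ι × κ) :=
  LinearMap.toContinuousBilinearMap <| LinearMap.mk₂ ℝ
    (fun u w => WithLp.toLp 2 fun p => u p.1 * w p.2)
    (fun u u' w => by ext; simp [add_mul])
    (fun c u w => by ext; simp [mul_assoc])
    (fun u w w' => by ext; simp [mul_add])
    (fun c u w => by ext; simp [mul_left_comm])

theorem outer_apply_apply (u : EuclideanSpace ℝ ι) (w : EuclideanSpace ℝ κ) (p : ι × κ) :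
    outer u w p = u p.1 * w p.2 := rfl

theorem norm_outer_apply (u : EuclideanSpace ℝ ι) (w : EuclideanSpace ℝ κ) :
    ‖outer u w‖ = ‖u‖ * ‖w‖ := by
  rw [← sq_eq_sq₀ (norm_nonneg _) (by positivity), mul_pow, EuclideanSpace.norm_sq_eq,
    EuclideanSpace.norm_sq_eq, EuclideanSpace.norm_sq_eq, Fintype.sum_prod_type,
    Finset.sum_mul_sum]
  simp only [outer_apply_apply, norm_mul, mul_pow]

theorem norm_outer_le : ‖(outer : EuclideanSpace ℝ ι →L[ℝ] EuclideanSpace ℝ κ →L[ℝ] _)‖ ≤ 1 :=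
  ContinuousLinearMap.opNorm_le_bound₂ _ zero_le_one fun u w => by
    rw [norm_outer_apply, one_mul]

theorem inner_outer (G : EuclideanSpace ℝ (ι × κ)) (u : EuclideanSpace ℝ ι)
    (w : EuclideanSpace ℝ κ) : ⟪G, outer u w⟫ = ∑ i, ∑ j, u i * G (i, j) * w j := by
  simp only [PiLp.inner_apply, Fintype.sum_prod_type, outer_apply_apply, RCLike.inner_apply,
    conj_trivial]
  exact Finset.sum_congr rfl fun i _ => Finset.sum_congr rfl fun j _ => by ring

theorem inner_grad_outer (φ : E3 → E3) (x v w : E3) :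
    ⟪grad φ x, outer v w⟫ = ⟪fderiv ℝ φ x v, w⟫ := by
  have hv : v = ∑ i, v i • EuclideanSpace.single i (1 : ℝ) := by
    ext j; simp [Finset.sum_apply, Pi.single_apply]
  rw [inner_outer, Finset.sum_comm]
  conv_rhs => rw [hv, map_sum]
  simp only [PiLp.inner_apply, RCLike.inner_apply, conj_trivial, map_smul, WithLp.ofLp_sum,
    Finset.sum_apply, PiLp.smul_apply, smul_eq_mul, Finset.mul_sum, grad]
  exact Finset.sum_congr rfl fun j _ => Finset.sum_congr rfl fun i _ => by ring

theorem norm_fderiv_le_norm_grad (φ : E3 → E3) (x : E3) : ‖fderiv ℝ φ x‖ ≤ ‖grad φ x‖ := by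
  refine ContinuousLinearMap.opNorm_le_bound _ (norm_nonneg _) fun v => ?_
  set y := fderiv ℝ φ x v
  have hy : ‖y‖ * ‖y‖ ≤ ‖grad φ x‖ * ‖v‖ * ‖y‖ := by
    calc ‖y‖ * ‖y‖ = ⟪grad φ x, outer v y⟫ := by
          rw [inner_grad_outer, real_inner_self_eq_norm_mul_norm]
      _ ≤ ‖grad φ x‖ * ‖outer v y‖ := real_inner_le_norm _ _
      _ = ‖grad φ x‖ * ‖v‖ * ‖y‖ := by rw [norm_outer_apply, mul_assoc]
  rcases (norm_nonneg y).eq_or_lt with h0 | h0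
  · rw [← h0]; positivity
  · exact le_of_mul_le_mul_right hy h0

theorem grad_apply {φ : E3 → E3} {x : E3} (hφ : DifferentiableAt ℝ φ x) (i j : Fin 3) :
    grad φ x (i, j) = fderiv ℝ (fun y => φ y j) x (EuclideanSpace.single i (1 : ℝ)) := by
  have h := ((PiLp.proj (𝕜 := ℝ) 2 (fun _ : Fin 3 => ℝ) j).hasFDerivAt.comp x
    hφ.hasFDerivAt).fderiv
  simp only [Function.comp_def, PiLp.proj_apply] at h
  simp [h, grad]

theorem grad_zero : grad 0 = 0 := by
  ext x p
  simp [grad]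

theorem grad_add {φ χ : E3 → E3} (hφ : Differentiable ℝ φ) (hχ : Differentiable ℝ χ) :
    grad (φ + χ) = grad φ + grad χ := by
  ext x p
  simp [grad, fderiv_add (hφ x) (hχ x)]

theorem grad_smul (c : ℝ) {φ : E3 → E3} (hφ : Differentiable ℝ φ) :
    grad (c • φ) = c • grad φ := by
  ext x p
  simp [grad, fderiv_const_smul (hφ x) c]

theorem support_grad_subset (φ : E3 → E3) : Function.support (grad φ) ⊆ tsupport φ := by
  intro x hx
  refine support_fderiv_subset ℝ fun h => hx ?_
  ext p
  simp [grad, h]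

end Gradient

variable {Ω : Set E3}

namespace IsSolenoidalTest

variable {φ χ : E3 → E3}

theorem differentiable (hφ : IsSolenoidalTest Ω φ) : Differentiable ℝ φ :=
  hφ.smooth.differentiable (by simp)

theorem zero : IsSolenoidalTest Ω (0 : E3 → E3) where
  smooth := contDiff_const
  compact_support := HasCompactSupport.zero
  support_subset := by simp
  div_free x := by simp [grad_zero]

theorem add (hφ : IsSolenoidalTest Ω φ) (hχ : IsSolenoidalTest Ω χ) :
    IsSolenoidalTest Ω (φ + χ) where
  smooth := hφ.smooth.add hχ.smooth
  compact_support := hφ.compact_support.add hχ.compact_support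
  support_subset := (tsupport_add φ χ).trans (union_subset hφ.support_subset hχ.support_subset)
  div_free x := by
    rw [grad_add hφ.differentiable hχ.differentiable]
    simp [Finset.sum_add_distrib, hφ.div_free x, hχ.div_free x]

theorem smul (c : ℝ) (hφ : IsSolenoidalTest Ω φ) : IsSolenoidalTest Ω (c • φ) where
  smooth := contDiff_const.smul hφ.smooth
  compact_support := hφ.compact_support.smul_left (f := fun _ => c)
  support_subset := (tsupport_smul_subset_right (fun _ => c) φ).trans hφ.support_subset
  div_free x := by
    rw [grad_smul c hφ.differentiable]
    simp [← Finset.mul_sum, hφ.div_free x]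

end IsSolenoidalTest

/-- The subspace of `V` of the classes of the test fields in `𝒱`, which is dense by the definition
of `V`. -/
def testFields (Ω : Set E3) : Submodule ℝ (V Ω) where
  carrier := {U | ∃ φ, IsSolenoidalTest Ω φ ∧ fieldV U =ᵐ[volume.restrict Ω] φ ∧
    gradV U =ᵐ[volume.restrict Ω] grad φ}
  zero_mem' := ⟨0, IsSolenoidalTest.zero, Lp.coeFn_zero _ _ _, by
    rw [grad_zero]; exact Lp.coeFn_zero _ _ _⟩
  add_mem' := by
    rintro U W ⟨φ, hφ, h1, h2⟩ ⟨χ, hχ, h3, h4⟩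
    refine ⟨φ + χ, hφ.add hχ, (Lp.coeFn_add _ _).trans (h1.add h3), ?_⟩
    rw [grad_add hφ.differentiable hχ.differentiable]
    exact (Lp.coeFn_add _ _).trans (h2.add h4)
  smul_mem' := by
    rintro c U ⟨φ, hφ, h1, h2⟩
    refine ⟨c • φ, hφ.smul c, (Lp.coeFn_smul _ _).trans (h1.const_smul c), ?_⟩
    rw [grad_smul c hφ.differentiable]
    exact (Lp.coeFn_smul _ _).trans (h2.const_smul c)

theorem dense_testFields : Dense (testFields Ω : Set (V Ω)) := by
  intro U
  rw [closure_subtype]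
  refine closure_mono ?_ U.2
  suffices h : Submodule.span ℝ {p : WithLp 2 (L2 Ω × L2Mat Ω) | ∃ φ, IsSolenoidalTest Ω φ ∧
      p.fst =ᵐ[volume.restrict Ω] φ ∧ p.snd =ᵐ[volume.restrict Ω] grad φ} ≤
      (testFields Ω).map (V Ω).subtype from h
  refine Submodule.span_le.2 fun p hp => ?_
  exact ⟨⟨p, subset_closure (Submodule.subset_span hp)⟩, hp, rfl⟩

/-- The inclusion `fieldV` of `V` in `(L²(Ω))³` as a continuous linear map. -/
noncomputable def fieldL : V Ω →L[ℝ] L2 Ω :=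
  (WithLp.fstL 2 ℝ (L2 Ω) (L2Mat Ω)).comp (V Ω).subtypeL

/-- The gradient `gradV` as a continuous linear map from `V` to `(L²(Ω))^{3 × 3}`. -/
noncomputable def gradL : V Ω →L[ℝ] L2Mat Ω :=
  (WithLp.sndL 2 ℝ (L2 Ω) (L2Mat Ω)).comp (V Ω).subtypeL

theorem gradL_apply (U : V Ω) : gradL U = gradV U := rfl

theorem fieldV_mem_H (U : V Ω) : fieldV U ∈ H Ω := by
  have h : fieldL U ∈ closure (fieldL '' (testFields Ω : Set (V Ω))) :=
    fieldL.continuous.continuousWithinAt.mem_closure_image (dense_testFields U)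
  refine closure_mono ?_ h
  rintro _ ⟨W, ⟨φ, hφ, h1, -⟩, rfl⟩
  exact Submodule.subset_span ⟨φ, hφ, h1⟩

/-- The inclusion of `V` in `H`. -/
noncomputable def inclH : V Ω →L[ℝ] H Ω := fieldL.codRestrict (H Ω) fieldV_mem_H

theorem coe_inclH (U : V Ω) : (inclH U : L2 Ω) = fieldV U := rfl

theorem norm_sq_V (U : V Ω) : ‖U‖ ^ 2 = ‖fieldV U‖ ^ 2 + normV U ^ 2 :=
  WithLp.prod_norm_sq_eq_of_L2 (U : WithLp 2 (L2 Ω × L2Mat Ω))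

theorem normV_nonneg (U : V Ω) : 0 ≤ normV U := norm_nonneg _

theorem normV_le_norm (U : V Ω) : normV U ≤ ‖U‖ := by
  refine le_of_sq_le_sq ?_ (norm_nonneg _)
  rw [norm_sq_V]
  exact le_add_of_nonneg_left (sq_nonneg _)

theorem norm_fieldV_le_norm (U : V Ω) : ‖fieldV U‖ ≤ ‖U‖ := by
  refine le_of_sq_le_sq ?_ (norm_nonneg _)
  rw [norm_sq_V]
  exact le_add_of_nonneg_right (sq_nonneg _)

theorem continuous_normV : Continuous (normV : V Ω → ℝ) := gradL.continuous.norm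

/-! ### Sobolev and Hölder inequalities -/

section Holder

variable {α E : Type*} [MeasurableSpace α] {μ : Measure α} [NormedAddCommGroup E] {f : α → E}
  {p q r : ENNReal}

theorem eLpNorm_le_eLpNorm_mul_one_add_measure_univ (hf : AEStronglyMeasurable f μ) (hp : 1 ≤ p)
    (hpq : p ≤ q) : eLpNorm f p μ ≤ eLpNorm f q μ * (1 + μ univ) := by
  have hinv : p⁻¹ ≤ 1 := ENNReal.inv_le_one.2 hp
  have hexp₀ : 0 ≤ 1 / p.toReal - 1 / q.toReal := by
    rw [one_div, one_div, ← ENNReal.toReal_inv, ← ENNReal.toReal_inv, sub_nonneg]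
    exact ENNReal.toReal_mono (hinv.trans_lt ENNReal.one_lt_top).ne (ENNReal.inv_le_inv.2 hpq)
  have hexp₁ : 1 / p.toReal - 1 / q.toReal ≤ 1 := by
    refine (sub_le_self _ (by positivity)).trans ?_
    rw [one_div, ← ENNReal.toReal_inv]
    exact ENNReal.toReal_mono ENNReal.one_ne_top hinv
  calc eLpNorm f p μ ≤ eLpNorm f q μ * μ univ ^ (1 / p.toReal - 1 / q.toReal) :=
        eLpNorm_le_eLpNorm_mul_rpow_measure_univ hpq hf
    _ ≤ eLpNorm f q μ * (1 + μ univ) ^ (1 / p.toReal - 1 / q.toReal) := by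
        gcongr
        exact le_add_self
    _ ≤ eLpNorm f q μ * (1 + μ univ) := by
        gcongr
        exact (ENNReal.rpow_le_rpow_of_exponent_le le_self_add hexp₁).trans_eq (ENNReal.rpow_one _)

theorem eLpNorm_le_rpow_half_mul_rpow_half (hf : AEStronglyMeasurable f μ)
    [ENNReal.HolderTriple (2 * p) (2 * q) r] :
    eLpNorm f r μ ≤ eLpNorm f p μ ^ (1 / 2 : ℝ) * eLpNorm f q μ ^ (1 / 2 : ℝ) := by
  have hhalf : ∀ e : ENNReal, eLpNorm (fun x => ‖f x‖ ^ (1 / 2 : ℝ)) (2 * e) μ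
      = eLpNorm f e μ ^ (1 / 2 : ℝ) := fun e => by
    have h2 : 2 * e * ENNReal.ofReal (1 / 2) = e := by
      rw [mul_right_comm, ENNReal.ofReal_div_of_pos two_pos, ENNReal.ofReal_one,
        ENNReal.ofReal_ofNat, one_div, ENNReal.mul_inv_cancel two_ne_zero (by simp), one_mul]
    rw [eLpNorm_norm_rpow f (by norm_num), h2]
  have hmeas : AEStronglyMeasurable (fun x => ‖f x‖ ^ (1 / 2 : ℝ)) μ :=
    (Real.continuous_rpow_const (by norm_num)).comp_aestronglyMeasurable hf.norm
  calc eLpNorm f r μ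
      = eLpNorm ((fun x => ‖f x‖ ^ (1 / 2 : ℝ)) • fun x => ‖f x‖ ^ (1 / 2 : ℝ)) r μ := by
        rw [← eLpNorm_norm]
        congr 1
        ext x
        simp only [Pi.smul_apply', smul_eq_mul, ← Real.sqrt_eq_rpow,
          Real.mul_self_sqrt (norm_nonneg _)]
    _ ≤ _ := eLpNorm_smul_le_mul_eLpNorm (p := 2 * p) (q := 2 * q) hmeas hmeas
    _ = _ := by rw [hhalf, hhalf]

theorem eLpNorm_norm_rpow_le (hf : AEStronglyMeasurable f μ) {s : ℝ} (hs : 0 ≤ s)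
    (hpq : p * ENNReal.ofReal s ≤ q) :
    eLpNorm (fun x => ‖f x‖ ^ s) p μ ≤
      eLpNorm f q μ ^ s * μ univ ^ (1 / p.toReal - s / q.toReal) := by
  rcases hs.eq_or_lt with rfl | hs
  · simpa using eLpNorm_le_of_ae_bound (f := fun _ => (1 : ℝ)) (p := p) (μ := μ) (C := 1)
      (Eventually.of_forall fun _ => by simp)
  rw [eLpNorm_norm_rpow f hs]
  refine (ENNReal.rpow_le_rpow (eLpNorm_le_eLpNorm_mul_rpow_measure_univ hpq hf) hs.le).trans_eq ?_
  rw [ENNReal.mul_rpow_of_nonneg _ _ hs.le, ← ENNReal.rpow_mul, ENNReal.toReal_mul,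
    ENNReal.toReal_ofReal hs.le]
  congr 2
  rw [sub_mul, one_div_mul_eq_div q.toReal, one_div, mul_inv, inv_mul_cancel_right₀ hs.ne',
    one_div]

end Holder

theorem eLpNorm_six_le_of_mem_testFields {U : V Ω} (hU : U ∈ testFields Ω) :
    eLpNorm (fieldV U) 6 (volume.restrict Ω) ≤
      SNormLESNormFDerivOfEqConst E3 (volume : Measure E3) 2 * ENNReal.ofReal (normV U) := by
  obtain ⟨φ, hφ, h1, h2⟩ := hU
  have hS := eLpNorm_le_eLpNorm_fderiv_of_eq (volume : Measure E3) (u := φ)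
    (hφ.smooth.of_le (by simp)) hφ.compact_support (p := 2) (p' := 6) (by norm_num) (by simp)
    (by simp; norm_num)
  calc eLpNorm (fieldV U) 6 (volume.restrict Ω) = eLpNorm φ 6 (volume.restrict Ω) :=
        eLpNorm_congr_ae h1
    _ ≤ eLpNorm φ 6 volume := eLpNorm_restrict_le _ _ _ _
    _ ≤ SNormLESNormFDerivOfEqConst E3 (volume : Measure E3) 2 *
        eLpNorm (fderiv ℝ φ) 2 volume := by simpa using hS
    _ ≤ SNormLESNormFDerivOfEqConst E3 (volume : Measure E3) 2 * eLpNorm (grad φ) 2 volume := by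
      gcongr
      exact eLpNorm_mono (norm_fderiv_le_norm_grad φ)
    _ = SNormLESNormFDerivOfEqConst E3 (volume : Measure E3) 2 *
        ENNReal.ofReal (normV U) := by
      congr 1
      rw [← eLpNorm_restrict_eq_of_support_subset
        ((support_grad_subset φ).trans hφ.support_subset), ← eLpNorm_congr_ae h2, normV,
        Lp.norm_def, ENNReal.ofReal_toReal (Lp.eLpNorm_ne_top _)]

theorem eLpNorm_six_le (U : V Ω) :
    eLpNorm (fieldV U) 6 (volume.restrict Ω) ≤
      SNormLESNormFDerivOfEqConst E3 (volume : Measure E3) 2 * ENNReal.ofReal (normV U) := by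
  set S := SNormLESNormFDerivOfEqConst E3 (volume : Measure E3) 2
  obtain ⟨p, hp, hlim⟩ := mem_closure_iff_seq_limit.1 (dense_testFields (Ω := Ω) U)
  have hL2 : Tendsto (fun n => fieldV (p n)) atTop (𝓝 (fieldV U)) :=
    (fieldL.continuous.tendsto U).comp hlim
  obtain ⟨ns, hns, hae⟩ := (tendstoInMeasure_of_tendsto_Lp hL2).exists_seq_tendsto_ae
  have hgrad : Tendsto (fun n => (S : ENNReal) * ENNReal.ofReal (normV (p (ns n)))) atTop
      (𝓝 (S * ENNReal.ofReal (normV U))) :=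
    ENNReal.Tendsto.const_mul (ENNReal.tendsto_ofReal <|
      (continuous_normV.tendsto U).comp (hlim.comp hns.tendsto_atTop)) (Or.inr ENNReal.coe_ne_top)
  refine (Lp.eLpNorm_lim_le_liminf_eLpNorm
    (fun n => Lp.aestronglyMeasurable (fieldV (p (ns n)))) _ hae).trans ?_
  rw [← hgrad.liminf_eq]
  exact liminf_le_liminf (Eventually.of_forall fun n => eLpNorm_six_le_of_mem_testFields (hp _))

/-- `K` bounds the volume of `Ω` and, for `1 ≤ p ≤ 6`, the constant of the embedding of `V` with
the norm `normV` in `(L^p(Ω))³`; for `p = 2` this is the Poincaré inequality. -/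
structure IsSobolevConst (Ω : Set E3) (K : ℝ) : Prop where
  one_le : 1 ≤ K
  volume_le : volume Ω ≤ ENNReal.ofReal K
  eLpNorm_le : ∀ p : ENNReal, 1 ≤ p → p ≤ 6 → ∀ U : V Ω,
    eLpNorm (fieldV U) p (volume.restrict Ω) ≤ ENNReal.ofReal (K * normV U)

theorem exists_isSobolevConst (hΩ : volume Ω ≠ ⊤) : ∃ K, IsSobolevConst Ω K := by
  set S : ℝ := ((SNormLESNormFDerivOfEqConst E3 (volume : Measure E3) 2 : NNReal) : ℝ) with hS
  set v : ℝ := (volume Ω).toReal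
  have hS₀ : 0 ≤ S := NNReal.coe_nonneg _
  have hv₀ : 0 ≤ v := ENNReal.toReal_nonneg
  have hvΩ : ENNReal.ofReal v = volume Ω := ENNReal.ofReal_toReal hΩ
  have hSv := mul_nonneg hS₀ hv₀
  refine ⟨(1 + S) * (1 + v), by nlinarith, ?_, fun p hp₁ hp₆ U => ?_⟩
  · rw [← hvΩ]
    exact ENNReal.ofReal_le_ofReal (by nlinarith)
  have hU := normV_nonneg U
  calc eLpNorm (fieldV U) p (volume.restrict Ω)
      ≤ eLpNorm (fieldV U) 6 (volume.restrict Ω) * (1 + volume.restrict Ω univ) :=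
        eLpNorm_le_eLpNorm_mul_one_add_measure_univ (Lp.aestronglyMeasurable _) hp₁ hp₆
    _ ≤ ENNReal.ofReal (S * normV U) * ENNReal.ofReal (1 + v) := by
        rw [Measure.restrict_apply_univ, ENNReal.ofReal_mul hS₀, hS, ENNReal.ofReal_coe_nnreal,
          ENNReal.ofReal_add zero_le_one hv₀, ENNReal.ofReal_one, hvΩ]
        gcongr
        exact eLpNorm_six_le U
    _ ≤ ENNReal.ofReal ((1 + S) * (1 + v) * normV U) := by
        rw [← ENNReal.ofReal_mul (by positivity)]
        exact ENNReal.ofReal_le_ofReal (by nlinarith [mul_nonneg hU hv₀])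

namespace IsSobolevConst

variable {K : ℝ}

theorem nonneg (hK : IsSobolevConst Ω K) : 0 ≤ K := zero_le_one.trans hK.one_le

theorem sqrt_le (hK : IsSobolevConst Ω K) : √K ≤ K :=
  Real.sqrt_le_iff.2 ⟨hK.nonneg, le_self_pow₀ hK.one_le two_ne_zero⟩

theorem memLp (hK : IsSobolevConst Ω K) {p : ENNReal} (hp₁ : 1 ≤ p) (hp₆ : p ≤ 6) (U : V Ω) :
    MemLp (fieldV U) p (volume.restrict Ω) :=
  ⟨Lp.aestronglyMeasurable _, (hK.eLpNorm_le p hp₁ hp₆ U).trans_lt ENNReal.ofReal_lt_top⟩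

theorem norm_toLp_le (hK : IsSobolevConst Ω K) {p : ENNReal} (hp₁ : 1 ≤ p) (hp₆ : p ≤ 6)
    (U : V Ω) : ‖(hK.memLp hp₁ hp₆ U).toLp‖ ≤ K * normV U := by
  rw [Lp.norm_toLp]
  exact ENNReal.toReal_le_of_le_ofReal (mul_nonneg hK.nonneg (normV_nonneg U))
    (hK.eLpNorm_le p hp₁ hp₆ U)

/-- The Sobolev embedding of `V` in `(L^p(Ω))³` for `1 ≤ p ≤ 6`. -/
noncomputable def fieldLp (hK : IsSobolevConst Ω K) {p : ENNReal} [hp₁ : Fact (1 ≤ p)]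
    (hp₆ : p ≤ 6) : V Ω →L[ℝ] Lp E3 p (volume.restrict Ω) :=
  LinearMap.mkContinuous
    { toFun := fun U => (hK.memLp hp₁.out hp₆ U).toLp
      map_add' := fun U W => by
        rw [← MemLp.toLp_add]
        exact MemLp.toLp_congr _ _ (Lp.coeFn_add (fieldV U) (fieldV W))
      map_smul' := fun c U => by
        rw [RingHom.id_apply, ← MemLp.toLp_const_smul]
        exact MemLp.toLp_congr _ _ (Lp.coeFn_smul c (fieldV U)) }
    K fun U => (hK.norm_toLp_le hp₁.out hp₆ U).trans <|
      mul_le_mul_of_nonneg_left (normV_le_norm U) hK.nonneg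

theorem coeFn_fieldLp (hK : IsSobolevConst Ω K) {p : ENNReal} [hp₁ : Fact (1 ≤ p)]
    (hp₆ : p ≤ 6) (U : V Ω) : hK.fieldLp hp₆ U =ᵐ[volume.restrict Ω] fieldV U :=
  (hK.memLp hp₁.out hp₆ U).coeFn_toLp

theorem norm_fieldLp_le (hK : IsSobolevConst Ω K) {p : ENNReal} [hp₁ : Fact (1 ≤ p)]
    (hp₆ : p ≤ 6) (U : V Ω) : ‖hK.fieldLp hp₆ U‖ ≤ K * normV U :=
  hK.norm_toLp_le hp₁.out hp₆ U

end IsSobolevConst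

/-! ### The convection term -/

section Convection

variable {K : ℝ}

theorem b_eq_integral_inner (U W Z : V Ω) :
    b U W Z = ∫ x in Ω, ⟪gradV W x, outer (fieldV U x) (fieldV Z x)⟫ := by
  simp only [b, inner_outer]

theorem norm_holder_outer_le {ι κ X : Type*} [Fintype ι] [Fintype κ] [MeasurableSpace X]
    {ν : Measure X} {p q r : ENNReal} [ENNReal.HolderTriple p q r]
    (f : Lp (EuclideanSpace ℝ ι) p ν) (g : Lp (EuclideanSpace ℝ κ) q ν) :
    ‖outer.holder r f g‖ ≤ ‖f‖ * ‖g‖ := by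
  have hholder := outer.norm_holder_apply_apply_le (r := r) f g
  refine hholder.trans (mul_le_mul_of_nonneg_right ?_ ENNReal.toReal_nonneg)
  exact mul_le_of_le_one_left ENNReal.toReal_nonneg norm_outer_le

instance holderTriple_six_three_two : ENNReal.HolderTriple 6 3 2 where
  inv_add_inv_eq_inv := by
    rw [← ENNReal.toReal_eq_toReal_iff' (by simp) (by simp), ENNReal.toReal_add (by simp) (by simp)]
    norm_num

instance holderTriple_four_twelve_three : ENNReal.HolderTriple (2 * 2) (2 * 6) 3 where
  inv_add_inv_eq_inv := by
    rw [← ENNReal.toReal_eq_toReal_iff' (by simp) (by simp), ENNReal.toReal_add (by simp) (by simp)]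
    norm_num

instance fact_one_le_six : Fact ((1 : ENNReal) ≤ 6) := ⟨by norm_num⟩

instance fact_one_le_three : Fact ((1 : ENNReal) ≤ 3) := ⟨by norm_num⟩

theorem three_le_six : (3 : ENNReal) ≤ 6 := by norm_num

namespace IsSobolevConst

/-- The tensor product `u ⊗ w ∈ L²` of two elements of `V`, formed with `u ∈ L⁶` and `w ∈ L³`. -/
noncomputable def tensor (hK : IsSobolevConst Ω K) : V Ω →L[ℝ] V Ω →L[ℝ] L2Mat Ω :=
  (outer.holderL (volume.restrict Ω) 6 3 2).bilinearComp (hK.fieldLp le_rfl)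
    (hK.fieldLp three_le_six)

theorem coeFn_tensor (hK : IsSobolevConst Ω K) (U Z : V Ω) :
    hK.tensor U Z =ᵐ[volume.restrict Ω] fun x => outer (fieldV U x) (fieldV Z x) := by
  filter_upwards [outer.coeFn_holder (r := 2) (hK.fieldLp le_rfl U) (hK.fieldLp three_le_six Z),
    hK.coeFn_fieldLp le_rfl U, hK.coeFn_fieldLp three_le_six Z] with x hx hU hZ
  rw [← hU, ← hZ]
  exact hx

theorem norm_tensor_le (hK : IsSobolevConst Ω K) (U Z : V Ω) :
    ‖hK.tensor U Z‖ ≤ K * normV U * ‖hK.fieldLp three_le_six Z‖ :=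
  (norm_holder_outer_le _ _).trans <|
    mul_le_mul_of_nonneg_right (hK.norm_fieldLp_le le_rfl U) (norm_nonneg _)

theorem b_eq_inner_tensor (hK : IsSobolevConst Ω K) (U W Z : V Ω) :
    b U W Z = ⟪gradV W, hK.tensor U Z⟫ := by
  rw [b_eq_integral_inner, L2.inner_def]
  refine integral_congr_ae ?_
  filter_upwards [hK.coeFn_tensor U Z] with x hx
  rw [hx]

theorem b_add_left (hK : IsSobolevConst Ω K) (U U' W Z : V Ω) :
    b (U + U') W Z = b U W Z + b U' W Z := by
  simp only [hK.b_eq_inner_tensor, map_add, add_apply, inner_add_right]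

theorem b_add_middle (hK : IsSobolevConst Ω K) (U W W' Z : V Ω) :
    b U (W + W') Z = b U W Z + b U W' Z := by
  simp only [hK.b_eq_inner_tensor, ← gradL_apply, map_add, inner_add_left]

theorem norm_fieldLp_three_le (hK : IsSobolevConst Ω K) (U : V Ω) :
    ‖hK.fieldLp three_le_six U‖ ≤ K * (√‖fieldV U‖ * √(normV U)) := by
  have hinterp : ‖hK.fieldLp three_le_six U‖ ≤ √‖fieldV U‖ * √(K * normV U) := by
    refine ENNReal.toReal_le_of_le_ofReal (by positivity) ?_
    calc eLpNorm (hK.fieldLp three_le_six U) 3 (volume.restrict Ω)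
        = eLpNorm (fieldV U) 3 (volume.restrict Ω) :=
          eLpNorm_congr_ae (hK.coeFn_fieldLp three_le_six U)
      _ ≤ eLpNorm (fieldV U) 2 (volume.restrict Ω) ^ (1 / 2 : ℝ) *
          eLpNorm (fieldV U) 6 (volume.restrict Ω) ^ (1 / 2 : ℝ) :=
        eLpNorm_le_rpow_half_mul_rpow_half (Lp.aestronglyMeasurable _)
      _ ≤ ENNReal.ofReal ‖fieldV U‖ ^ (1 / 2 : ℝ) *
          ENNReal.ofReal (K * normV U) ^ (1 / 2 : ℝ) := by
        rw [Lp.norm_def, ENNReal.ofReal_toReal (Lp.eLpNorm_ne_top _)]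
        gcongr
        exact hK.eLpNorm_le 6 (by norm_num) le_rfl U
      _ = ENNReal.ofReal (√‖fieldV U‖ * √(K * normV U)) := by
        rw [ENNReal.ofReal_mul (Real.sqrt_nonneg _), Real.sqrt_eq_rpow, Real.sqrt_eq_rpow,
          ENNReal.ofReal_rpow_of_nonneg (norm_nonneg _) (by norm_num),
          ENNReal.ofReal_rpow_of_nonneg (mul_nonneg hK.nonneg (normV_nonneg U)) (by norm_num)]
  calc ‖hK.fieldLp three_le_six U‖ ≤ √‖fieldV U‖ * (√K * √(normV U)) := by
        rwa [← Real.sqrt_mul hK.nonneg]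
    _ ≤ √‖fieldV U‖ * (K * √(normV U)) := by gcongr; exact hK.sqrt_le
    _ = K * (√‖fieldV U‖ * √(normV U)) := by ring

theorem abs_b_le_mul_sqrt (hK : IsSobolevConst Ω K) (U W Z : V Ω) :
    |b U W Z| ≤ K ^ 2 * normV U * normV W * (√‖fieldV Z‖ * √(normV Z)) := by
  have hKU := mul_nonneg hK.nonneg (normV_nonneg U)
  calc |b U W Z| ≤ normV W * ‖hK.tensor U Z‖ := by
        rw [hK.b_eq_inner_tensor]
        exact abs_real_inner_le_norm _ _
    _ ≤ normV W * (K * normV U * (K * (√‖fieldV Z‖ * √(normV Z)))) :=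
        mul_le_mul_of_nonneg_left ((hK.norm_tensor_le U Z).trans
          (mul_le_mul_of_nonneg_left (hK.norm_fieldLp_three_le Z) hKU)) (normV_nonneg W)
    _ = K ^ 2 * normV U * normV W * (√‖fieldV Z‖ * √(normV Z)) := by ring

theorem abs_b_le (hK : IsSobolevConst Ω K) (U W Z : V Ω) :
    |b U W Z| ≤ K ^ 2 * normV U * normV W * normV Z := by
  have hKU := mul_nonneg hK.nonneg (normV_nonneg U)
  calc |b U W Z| ≤ normV W * ‖hK.tensor U Z‖ := by
        rw [hK.b_eq_inner_tensor]
        exact abs_real_inner_le_norm _ _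
    _ ≤ normV W * (K * normV U * (K * normV Z)) :=
        mul_le_mul_of_nonneg_left ((hK.norm_tensor_le U Z).trans
          (mul_le_mul_of_nonneg_left (hK.norm_fieldLp_le three_le_six Z) hKU)) (normV_nonneg W)
    _ = K ^ 2 * normV U * normV W * normV Z := by ring

/-- The functional `b(u, v, ·)` in `V'`. -/
noncomputable def bDual (hK : IsSobolevConst Ω K) (U W : V Ω) : VDual Ω :=
  (innerSL ℝ (gradL W)).comp (hK.tensor U)

theorem bDual_apply (hK : IsSobolevConst Ω K) (U W Z : V Ω) : hK.bDual U W Z = b U W Z :=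
  (hK.b_eq_inner_tensor U W Z).symm

theorem continuous_bDual_self (hK : IsSobolevConst Ω K) :
    Continuous fun U : V Ω => hK.bDual U U :=
  ((innerSL ℝ).continuous.comp gradL.continuous).clm_comp hK.tensor.continuous

end IsSobolevConst

namespace IsSolenoidalTest

variable {φ χ : E3 → E3}

theorem contDiff_apply (hφ : IsSolenoidalTest Ω φ) (j : Fin 3) : ContDiff ℝ ∞ fun x => φ x j :=
  contDiff_euclidean.1 hφ.smooth j

theorem continuous_grad_apply (hφ : IsSolenoidalTest Ω φ) (i j : Fin 3) :
    Continuous fun x => grad φ x (i, j) := by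
  simp_rw [grad_apply (hφ.differentiable _)]
  exact ((hφ.contDiff_apply j).continuous_fderiv (by simp)).clm_apply continuous_const

theorem integrable_mul_apply (hφ : IsSolenoidalTest Ω φ) {f : E3 → ℝ} (hf : Continuous f)
    (j : Fin 3) : Integrable fun x => f x * φ x j := by
  have hcs : HasCompactSupport fun x => φ x j :=
    hφ.compact_support.comp_left (g := fun y : E3 => y j) (by simp)
  exact (hf.mul (hφ.contDiff_apply j).continuous).integrable_of_hasCompactSupport hcs.mul_left

theorem two_mul_integral_mul_grad_mul (hφ : IsSolenoidalTest Ω φ) (hχ : IsSolenoidalTest Ω χ)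
    (i j : Fin 3) : 2 * ∫ x, φ x i * grad χ x (i, j) * χ x j
      = -∫ x, grad φ x (i, i) * χ x j * χ x j := by
  have hφi := (hφ.contDiff_apply i).continuous
  have hχj := (hχ.contDiff_apply j).continuous
  have hdφ := (hφ.contDiff_apply i).differentiable (by simp)
  have hdχ := (hχ.contDiff_apply j).differentiable (by simp)
  have hgφ := hφ.continuous_grad_apply i i
  have hgχ := hχ.continuous_grad_apply i j
  have hgrad : ∀ x, fderiv ℝ (fun y => χ y j) x (EuclideanSpace.single i (1 : ℝ))
      = grad χ x (i, j) := fun x => (grad_apply (hχ.differentiable x) i j).symm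
  have hprod : ∀ x, fderiv ℝ (fun y => φ y i * χ y j) x (EuclideanSpace.single i (1 : ℝ))
      = grad φ x (i, i) * χ x j + φ x i * grad χ x (i, j) := fun x => by
    rw [fderiv_fun_mul (hdφ x) (hdχ x), grad_apply (hφ.differentiable x), ← hgrad]
    simp only [add_apply, smul_apply, smul_eq_mul]
    ring
  have hint₁ : Integrable fun x => grad φ x (i, i) * χ x j * χ x j :=
    hχ.integrable_mul_apply (hgφ.mul hχj) j
  have hint₂ : Integrable fun x => φ x i * grad χ x (i, j) * χ x j :=
    hχ.integrable_mul_apply (hφi.mul hgχ) j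
  have hcomm : (fun x => φ x i * χ x j * grad χ x (i, j))
      = fun x => φ x i * grad χ x (i, j) * χ x j := funext fun x => mul_right_comm _ _ _
  have hparts := integral_mul_fderiv_eq_neg_fderiv_mul_of_integrable (μ := (volume : Measure E3))
    (f := fun x => φ x i * χ x j) (g := fun x => χ x j) (v := EuclideanSpace.single i (1 : ℝ))
    (by simp only [hprod, add_mul]; exact hint₁.add hint₂)
    (by simp only [hgrad, hcomm]; exact hint₂)
    (hχ.integrable_mul_apply (hφi.mul hχj) j) (fun x _ => (hdφ x).mul (hdχ x))
    (fun x _ => hdχ x)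
  simp only [hprod, hgrad, hcomm, add_mul] at hparts
  rw [integral_add hint₁ hint₂] at hparts
  linarith

theorem integral_inner_grad_outer_self_eq_zero (hφ : IsSolenoidalTest Ω φ)
    (hχ : IsSolenoidalTest Ω χ) : ∫ x, ⟪grad χ x, outer (φ x) (χ x)⟫ = 0 := by
  have hint : ∀ i j : Fin 3, Integrable fun x => φ x i * grad χ x (i, j) * χ x j := fun i j =>
    hχ.integrable_mul_apply ((hφ.contDiff_apply i).continuous.mul
      (hχ.continuous_grad_apply i j)) j
  have hint_div : ∀ i j : Fin 3, Integrable fun x => grad φ x (i, i) * χ x j * χ x j :=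
    fun i j => hχ.integrable_mul_apply ((hφ.continuous_grad_apply i i).mul
      (hχ.contDiff_apply j).continuous) j
  have hsum : ∫ x, ⟪grad χ x, outer (φ x) (χ x)⟫
      = ∑ i, ∑ j, ∫ x, φ x i * grad χ x (i, j) * χ x j := by
    simp only [inner_outer]
    rw [integral_finsetSum _ fun i _ => integrable_finsetSum _ fun j _ => hint i j]
    exact Finset.sum_congr rfl fun i _ => integral_finsetSum _ fun j _ => hint i j
  have htwice : 2 * ∫ x, ⟪grad χ x, outer (φ x) (χ x)⟫ = 0 := by
    simp only [hsum, Finset.mul_sum, hφ.two_mul_integral_mul_grad_mul hχ]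
    rw [Finset.sum_comm]
    refine Finset.sum_eq_zero fun j _ => ?_
    rw [Finset.sum_neg_distrib, ← integral_finsetSum _ fun i _ => hint_div i j]
    simp_rw [← Finset.sum_mul, hφ.div_free]
    simp
  exact (mul_eq_zero.1 htwice).resolve_left two_ne_zero

end IsSolenoidalTest

theorem b_self_eq_zero_of_mem_testFields {U W : V Ω} (hU : U ∈ testFields Ω)
    (hW : W ∈ testFields Ω) : b U W W = 0 := by
  obtain ⟨φ, hφ, h1, -⟩ := hU
  obtain ⟨χ, hχ, h3, h4⟩ := hW
  rw [b_eq_integral_inner, ← hφ.integral_inner_grad_outer_self_eq_zero hχ,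
    ← setIntegral_eq_integral_of_forall_compl_eq_zero (s := Ω)
      (f := fun x => ⟪grad χ x, outer (φ x) (χ x)⟫)]
  · refine integral_congr_ae ?_
    filter_upwards [h1, h3, h4] with x e1 e3 e4
    rw [e1, e3, e4]
  · intro x hx
    rw [image_eq_zero_of_notMem_tsupport fun h => hx (hφ.support_subset h), map_zero,
      zero_apply, inner_zero_right]

theorem IsSobolevConst.b_self_eq_zero (hK : IsSobolevConst Ω K) (U W : V Ω) : b U W W = 0 := by
  have hcont : Continuous fun p : V Ω × V Ω => ⟪gradL p.2, hK.tensor p.1 p.2⟫ :=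
    (gradL.continuous.comp continuous_snd).inner
      ((hK.tensor.continuous.comp continuous_fst).clm_apply continuous_snd)
  have hzero : (fun p : V Ω × V Ω => ⟪gradL p.2, hK.tensor p.1 p.2⟫) = fun _ => 0 := by
    refine hcont.ext_on (dense_testFields.prod dense_testFields) continuous_const ?_
    rintro ⟨U, W⟩ ⟨hU, hW⟩
    exact (hK.b_eq_inner_tensor U W W).symm.trans (b_self_eq_zero_of_mem_testFields hU hW)
  exact (hK.b_eq_inner_tensor U W W).trans (congrFun hzero (U, W))

end Convection

/-! ### The damping term -/

theorem mul_rpow_sub_rpow_le {s p r : ℝ} (hs₀ : 0 ≤ s) (hs₂ : s ≤ 2) (hp : 0 ≤ p) (hpr : p ≤ r) :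
    r * (r ^ s - p ^ s) ≤ 2 * r ^ s * (r - p) := by
  rcases (hp.trans hpr).eq_or_lt with rfl | hr
  · simp [le_antisymm hpr hp]
  obtain ⟨q, rfl⟩ : ∃ q, p = r * q := ⟨p / r, (mul_div_cancel₀ p hr.ne').symm⟩
  have hq₀ : 0 ≤ q := nonneg_of_mul_nonneg_right hp hr
  have hq₁ : q ≤ 1 := le_of_mul_le_mul_left (hpr.trans_eq (mul_one r).symm) hr
  have hsq : q ^ 2 ≤ q ^ s := by
    simpa using Real.rpow_le_rpow_of_exponent_ge' hq₀ hq₁ hs₀ hs₂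
  have hbernoulli : 1 - q ^ s ≤ 2 * (1 - q) := by nlinarith [sq_nonneg (q - 1)]
  calc r * (r ^ s - (r * q) ^ s) = r * r ^ s * (1 - q ^ s) := by
        rw [Real.mul_rpow hr.le hq₀]; ring
    _ ≤ r * r ^ s * (2 * (1 - q)) := by gcongr
    _ = 2 * r ^ s * (r - r * q) := by ring

section Damp

variable {E : Type*} {s : ℝ}

/-- The damping nonlinearity `|a|^s a`. -/
noncomputable def damp [Norm E] [SMul ℝ E] (s : ℝ) (a : E) : E := ‖a‖ ^ s • a

section NormedSpace

variable [NormedAddCommGroup E] [NormedSpace ℝ E]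

theorem continuous_damp (hs : 0 ≤ s) : Continuous (damp s : E → E) :=
  (continuous_norm.rpow_const fun _ => Or.inr hs).smul continuous_id

theorem norm_damp_sub_le_of_norm_le (hs₀ : 0 ≤ s) (hs₂ : s ≤ 2) {a b : E} (hba : ‖b‖ ≤ ‖a‖) :
    ‖damp s a - damp s b‖ ≤ 3 * (‖a‖ ^ s * ‖a - b‖) := by
  have hrpow : 0 ≤ ‖a‖ ^ s - ‖b‖ ^ s :=
    sub_nonneg.2 (Real.rpow_le_rpow (norm_nonneg _) hba hs₀)
  have hdiff : (‖a‖ ^ s - ‖b‖ ^ s) * ‖b‖ ≤ 2 * ‖a‖ ^ s * ‖a - b‖ := by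
    calc (‖a‖ ^ s - ‖b‖ ^ s) * ‖b‖ ≤ (‖a‖ ^ s - ‖b‖ ^ s) * ‖a‖ := by gcongr
      _ ≤ 2 * ‖a‖ ^ s * (‖a‖ - ‖b‖) := by
        rw [mul_comm]; exact mul_rpow_sub_rpow_le hs₀ hs₂ (norm_nonneg _) hba
      _ ≤ 2 * ‖a‖ ^ s * ‖a - b‖ := by gcongr; exact norm_sub_norm_le _ _
  calc ‖damp s a - damp s b‖ = ‖‖a‖ ^ s • (a - b) + (‖a‖ ^ s - ‖b‖ ^ s) • b‖ := by
        simp only [damp, smul_sub, sub_smul, sub_add_sub_cancel]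
    _ ≤ ‖a‖ ^ s * ‖a - b‖ + (‖a‖ ^ s - ‖b‖ ^ s) * ‖b‖ := by
        refine (norm_add_le _ _).trans_eq ?_
        rw [norm_smul, norm_smul, Real.norm_of_nonneg (by positivity), Real.norm_of_nonneg hrpow]
    _ ≤ 3 * (‖a‖ ^ s * ‖a - b‖) := by linarith

theorem norm_damp_sub_le (hs₀ : 0 ≤ s) (hs₂ : s ≤ 2) (a b : E) :
    ‖damp s a - damp s b‖ ≤ 3 * ((‖a‖ + ‖b‖) ^ s * ‖a - b‖) := by
  rcases le_total ‖b‖ ‖a‖ with h | h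
  · refine (norm_damp_sub_le_of_norm_le hs₀ hs₂ h).trans ?_
    gcongr
    exact le_add_of_nonneg_right (norm_nonneg b)
  · rw [norm_sub_rev, norm_sub_rev a b]
    refine (norm_damp_sub_le_of_norm_le hs₀ hs₂ h).trans ?_
    gcongr
    exact le_add_of_nonneg_left (norm_nonneg a)

end NormedSpace

theorem inner_damp_sub_nonneg [NormedAddCommGroup E] [InnerProductSpace ℝ E] (hs : 0 ≤ s)
    (a b : E) : 0 ≤ ⟪damp s a - damp s b, a - b⟫ := by
  have hmono : 0 ≤ (‖a‖ ^ s * ‖a‖ - ‖b‖ ^ s * ‖b‖) * (‖a‖ - ‖b‖) := by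
    have hle : ∀ x y : E, ‖x‖ ≤ ‖y‖ → ‖x‖ ^ s * ‖x‖ ≤ ‖y‖ ^ s * ‖y‖ := fun x y h => by gcongr
    rcases le_total ‖b‖ ‖a‖ with h | h
    · exact mul_nonneg (sub_nonneg.2 (hle b a h)) (sub_nonneg.2 h)
    · exact mul_nonneg_of_nonpos_of_nonpos (sub_nonpos.2 (hle a b h)) (sub_nonpos.2 h)
  have hcs : (‖a‖ ^ s + ‖b‖ ^ s) * ⟪a, b⟫ ≤ (‖a‖ ^ s + ‖b‖ ^ s) * (‖a‖ * ‖b‖) := by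
    gcongr
    exact real_inner_le_norm a b
  calc 0 ≤ (‖a‖ ^ s * ‖a‖ - ‖b‖ ^ s * ‖b‖) * (‖a‖ - ‖b‖) := hmono
    _ = ‖a‖ ^ s * ‖a‖ ^ 2 + ‖b‖ ^ s * ‖b‖ ^ 2 - (‖a‖ ^ s + ‖b‖ ^ s) * (‖a‖ * ‖b‖) := by ring
    _ ≤ ‖a‖ ^ s * ‖a‖ ^ 2 + ‖b‖ ^ s * ‖b‖ ^ 2 - (‖a‖ ^ s + ‖b‖ ^ s) * ⟪a, b⟫ := by gcongr
    _ = ⟪damp s a - damp s b, a - b⟫ := by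
      simp only [damp, inner_sub_left, inner_sub_right, real_inner_smul_left,
        real_inner_self_eq_norm_sq, real_inner_comm a b]
      ring

end Damp

section Damping

variable {K β : ℝ}

theorem eLpNorm_norm_rpow_smul_le {X E E' : Type*} [MeasurableSpace X] {ν : Measure X}
    [NormedAddCommGroup E] [NormedAddCommGroup E'] [NormedSpace ℝ E'] {f : X → E} {g : X → E'}
    {p q r l : ENNReal} {s : ℝ} [ENNReal.HolderTriple p q r] (hf : AEStronglyMeasurable f ν)
    (hg : AEStronglyMeasurable g ν) (hs : 0 ≤ s) (hpl : p * ENNReal.ofReal s ≤ l) :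
    eLpNorm (fun x => ‖f x‖ ^ s • g x) r ν ≤
      eLpNorm f l ν ^ s * ν univ ^ (1 / p.toReal - s / l.toReal) * eLpNorm g q ν :=
  (eLpNorm_smul_le_mul_eLpNorm (p := p) (q := q) hg
    ((Real.continuous_rpow_const hs).comp_aestronglyMeasurable hf.norm)).trans
    (mul_le_mul_left (eLpNorm_norm_rpow_le hf hs hpl) _)

instance holderTriple_three_six_two : ENNReal.HolderTriple 3 6 2 :=
  ENNReal.HolderTriple.symm

namespace IsSobolevConst

theorem eLpNorm_norm_rpow_smul_fieldV_le (hK : IsSobolevConst Ω K) {s : ℝ} (hs₀ : 0 ≤ s)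
    (hs₂ : s ≤ 2) {E : Type*} [NormedAddCommGroup E] {f : E3 → E}
    (hf : AEStronglyMeasurable f (volume.restrict Ω)) {R : ℝ} (hR : 0 ≤ R)
    (hfR : eLpNorm f 6 (volume.restrict Ω) ≤ ENNReal.ofReal (K * R)) (U : V Ω) :
    eLpNorm (fun x => ‖f x‖ ^ s • fieldV U x) 2 (volume.restrict Ω) ≤
      ENNReal.ofReal (K ^ 4 * (R ^ s * normV U)) := by
  have hK₀ := hK.nonneg
  have hU := normV_nonneg U
  have hexp : (1 : ℝ) / (3 : ENNReal).toReal - s / (6 : ENNReal).toReal = (2 - s) / 6 := by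
    norm_num; ring
  have hthree : 3 * ENNReal.ofReal s ≤ 6 := by
    calc 3 * ENNReal.ofReal s ≤ 3 * ENNReal.ofReal 2 := by gcongr
      _ = 6 := by norm_num
  have hKpow : (K * R) ^ s * K ^ ((2 - s) / 6) ≤ K ^ 3 * R ^ s := by
    calc (K * R) ^ s * K ^ ((2 - s) / 6) = K ^ s * K ^ ((2 - s) / 6) * R ^ s := by
          rw [Real.mul_rpow hK₀ hR]; ring
      _ ≤ K ^ (2 : ℝ) * K ^ (1 : ℝ) * R ^ s := by
          gcongr
          exacts [hK.one_le, hK.one_le, by linarith]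
      _ = K ^ 3 * R ^ s := by rw [Real.rpow_two, Real.rpow_one]; ring
  calc eLpNorm (fun x => ‖f x‖ ^ s • fieldV U x) 2 (volume.restrict Ω)
      ≤ eLpNorm f 6 (volume.restrict Ω) ^ s * volume Ω ^ ((2 - s) / 6) *
          eLpNorm (fieldV U) 6 (volume.restrict Ω) := by
        rw [← hexp, ← Measure.restrict_apply_univ]
        exact eLpNorm_norm_rpow_smul_le hf (Lp.aestronglyMeasurable _) hs₀ hthree
    _ ≤ ENNReal.ofReal (K * R) ^ s * ENNReal.ofReal K ^ ((2 - s) / 6) *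
          ENNReal.ofReal (K * normV U) := by
        gcongr
        exacts [hK.volume_le, hK.eLpNorm_le 6 (by norm_num) le_rfl U]
    _ = ENNReal.ofReal ((K * R) ^ s * K ^ ((2 - s) / 6) * (K * normV U)) := by
        rw [ENNReal.ofReal_rpow_of_nonneg (by positivity) hs₀,
          ENNReal.ofReal_rpow_of_nonneg hK₀ (by linarith), ← ENNReal.ofReal_mul (by positivity),
          ← ENNReal.ofReal_mul (by positivity)]
    _ ≤ ENNReal.ofReal (K ^ 3 * R ^ s * (K * normV U)) := by gcongr
    _ = ENNReal.ofReal (K ^ 4 * (R ^ s * normV U)) := by ring_nf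

theorem eLpNorm_damp_le (hK : IsSobolevConst Ω K) (hβ₁ : 1 ≤ β) (hβ₃ : β ≤ 3) (U : V Ω) :
    eLpNorm (fun x => damp (β - 1) (fieldV U x)) 2 (volume.restrict Ω) ≤
      ENNReal.ofReal (K ^ 4 * (normV U ^ (β - 1) * normV U)) :=
  hK.eLpNorm_norm_rpow_smul_fieldV_le (by linarith) (by linarith) (Lp.aestronglyMeasurable _)
    (normV_nonneg U) (hK.eLpNorm_le 6 (by norm_num) le_rfl U) U

theorem memLp_damp (hK : IsSobolevConst Ω K) (hβ₁ : 1 ≤ β) (hβ₃ : β ≤ 3) (U : V Ω) :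
    MemLp (fun x => damp (β - 1) (fieldV U x)) 2 (volume.restrict Ω) :=
  ⟨(continuous_damp (by linarith)).comp_aestronglyMeasurable (Lp.aestronglyMeasurable _),
    (hK.eLpNorm_damp_le hβ₁ hβ₃ U).trans_lt ENNReal.ofReal_lt_top⟩

/-- The damping `|u|^{β - 1} u` of an element of `V`; it lies in `(L²(Ω))³` since `V ⊂ L⁶` and
`β ≤ 3`. -/
noncomputable def dampL2 (hK : IsSobolevConst Ω K) (hβ₁ : 1 ≤ β) (hβ₃ : β ≤ 3) (U : V Ω) : L2 Ω :=
  (hK.memLp_damp hβ₁ hβ₃ U).toLp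

theorem damping_eq_inner (hK : IsSobolevConst Ω K) (hβ₁ : 1 ≤ β) (hβ₃ : β ≤ 3) (U Z : V Ω) :
    damping β U Z = ⟪hK.dampL2 hβ₁ hβ₃ U, fieldV Z⟫ := by
  rw [L2.inner_def]
  refine integral_congr_ae ?_
  filter_upwards [(hK.memLp_damp hβ₁ hβ₃ U).coeFn_toLp] with x hx
  rw [dampL2, hx, damp, real_inner_smul_left]

theorem norm_dampL2_le (hK : IsSobolevConst Ω K) (hβ₁ : 1 ≤ β) (hβ₃ : β ≤ 3) (U : V Ω) :
    ‖hK.dampL2 hβ₁ hβ₃ U‖ ≤ K ^ 4 * (normV U ^ (β - 1) * normV U) := by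
  have hU := normV_nonneg U
  rw [dampL2, Lp.norm_toLp]
  exact ENNReal.toReal_le_of_le_ofReal (by positivity) (hK.eLpNorm_damp_le hβ₁ hβ₃ U)

theorem abs_damping_le (hK : IsSobolevConst Ω K) (hβ₁ : 1 ≤ β) (hβ₃ : β ≤ 3) (U Z : V Ω) :
    |damping β U Z| ≤ K ^ 4 * (normV U ^ (β - 1) * normV U) * ‖fieldV Z‖ := by
  rw [hK.damping_eq_inner hβ₁ hβ₃]
  exact (abs_real_inner_le_norm _ _).trans
    (mul_le_mul_of_nonneg_right (hK.norm_dampL2_le hβ₁ hβ₃ U) (norm_nonneg _))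

theorem norm_dampL2_sub_le (hK : IsSobolevConst Ω K) (hβ₁ : 1 ≤ β) (hβ₃ : β ≤ 3) (U W : V Ω) :
    ‖hK.dampL2 hβ₁ hβ₃ U - hK.dampL2 hβ₁ hβ₃ W‖ ≤
      3 * (K ^ 4 * ((normV U + normV W) ^ (β - 1) * normV (U - W))) := by
  have hK₀ := hK.nonneg
  have hU := normV_nonneg U
  have hW := normV_nonneg W
  have hUW := normV_nonneg (U - W)
  set g : E3 → ℝ := fun x => ‖fieldV U x‖ + ‖fieldV W x‖
  have hg : eLpNorm g 6 (volume.restrict Ω) ≤ ENNReal.ofReal (K * (normV U + normV W)) := by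
    refine (eLpNorm_add_le (Lp.aestronglyMeasurable (fieldV U)).norm
      (Lp.aestronglyMeasurable (fieldV W)).norm (by norm_num)).trans ?_
    rw [eLpNorm_norm, eLpNorm_norm, mul_add, ENNReal.ofReal_add (by positivity) (by positivity)]
    exact add_le_add (hK.eLpNorm_le 6 (by norm_num) le_rfl U)
      (hK.eLpNorm_le 6 (by norm_num) le_rfl W)
  have hpointwise : ∀ᵐ x ∂volume.restrict Ω,
      ‖damp (β - 1) (fieldV U x) - damp (β - 1) (fieldV W x)‖ ≤
        3 * ‖‖g x‖ ^ (β - 1) • fieldV (U - W) x‖ := by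
    filter_upwards [Lp.coeFn_sub (fieldV U) (fieldV W)] with x hx
    have hx' : fieldV (U - W) x = fieldV U x - fieldV W x := hx
    rw [norm_smul, Real.norm_of_nonneg (by positivity),
      Real.norm_of_nonneg (by positivity : 0 ≤ g x), hx']
    exact norm_damp_sub_le (by linarith) (by linarith) _ _
  rw [dampL2, dampL2, ← MemLp.toLp_sub, Lp.norm_toLp]
  refine ENNReal.toReal_le_of_le_ofReal (by positivity) ?_
  refine (eLpNorm_le_mul_eLpNorm_of_ae_le_mul hpointwise 2).trans ?_
  rw [ENNReal.ofReal_mul (by norm_num)]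
  gcongr
  exact hK.eLpNorm_norm_rpow_smul_fieldV_le (by linarith) (by linarith)
    ((Lp.aestronglyMeasurable _).norm.add (Lp.aestronglyMeasurable _).norm)
    (add_nonneg hU hW) hg (U - W)

theorem continuous_dampL2 (hK : IsSobolevConst Ω K) (hβ₁ : 1 ≤ β) (hβ₃ : β ≤ 3) :
    Continuous (hK.dampL2 hβ₁ hβ₃) := by
  refine continuous_iff_continuousAt.2 fun W => tendsto_iff_norm_sub_tendsto_zero.2 <|
    squeeze_zero (fun _ => norm_nonneg _) (fun U => hK.norm_dampL2_sub_le hβ₁ hβ₃ U W) ?_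
  have hbound : Continuous fun U : V Ω =>
      3 * (K ^ 4 * ((normV U + normV W) ^ (β - 1) * normV (U - W))) :=
    continuous_const.mul <| continuous_const.mul <|
      ((continuous_normV.add continuous_const).rpow_const fun _ => Or.inr (by linarith)).mul
        (continuous_normV.comp (continuous_id.sub continuous_const))
  have hzero : normV (0 : V Ω) = 0 := norm_zero (E := L2Mat Ω)
  simpa [hzero] using hbound.tendsto W

theorem damping_sub_nonneg (hK : IsSobolevConst Ω K) (hβ₁ : 1 ≤ β) (hβ₃ : β ≤ 3) (U W : V Ω) :
    0 ≤ damping β U (U - W) - damping β W (U - W) := by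
  rw [hK.damping_eq_inner hβ₁ hβ₃, hK.damping_eq_inner hβ₁ hβ₃, ← inner_sub_left, L2.inner_def]
  refine integral_nonneg_of_ae ?_
  filter_upwards [Lp.coeFn_sub (hK.dampL2 hβ₁ hβ₃ U) (hK.dampL2 hβ₁ hβ₃ W),
    Lp.coeFn_sub (fieldV U) (fieldV W), (hK.memLp_damp hβ₁ hβ₃ U).coeFn_toLp,
    (hK.memLp_damp hβ₁ hβ₃ W).coeFn_toLp] with x hx hUW hU hW
  have hUW' : fieldV (U - W) x = fieldV U x - fieldV W x := hUW
  rw [hx, Pi.sub_apply, hUW', dampL2, dampL2, hU, hW]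
  exact inner_damp_sub_nonneg (by linarith) _ _

end IsSobolevConst

end Damping

/-! ### The cutoff -/

section Cutoff

variable {M N p r : ℝ}

theorem F_eq_div_max (hN : 0 < N) (hr : 0 ≤ r) : F N r = N / max N r := by
  rcases hr.eq_or_lt with rfl | hr'
  · simp [F, hN.le, hN.ne']
  rw [F, if_neg hr'.ne']
  rcases le_total r N with h | h
  · rw [max_eq_left h, div_self hN.ne', min_eq_left ((one_le_div hr').2 h)]
  · rw [max_eq_right h, min_eq_right ((div_le_one hr').2 h)]

theorem F_nonneg (hN : 0 < N) (hr : 0 ≤ r) : 0 ≤ F N r := by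
  rw [F_eq_div_max hN hr]
  positivity

theorem F_le_one (N r : ℝ) : F N r ≤ 1 := by
  rw [F]
  split_ifs
  exacts [le_rfl, min_le_left _ _]

theorem F_mul_le (hN : 0 < N) (hr : 0 ≤ r) : F N r * r ≤ N := by
  rw [F_eq_div_max hN hr, div_mul_eq_mul_div, div_le_iff₀ (hN.trans_le (le_max_left _ _))]
  gcongr
  exact le_max_right _ _

theorem measurable_F (N : ℝ) : Measurable (F N) :=
  Measurable.ite (measurableSet_singleton 0) measurable_const
    (measurable_const.min (measurable_const.div measurable_id))

theorem abs_F_sub_F_mul_le (hM : 0 < M) (hN : 0 < N) (hp : 0 ≤ p) (hr : 0 ≤ r) :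
    |F M p - F N r| * p ≤ |M - N| + F N r * (|M - N| + |r - p|) := by
  have hF := F_nonneg hN hr
  rw [F_eq_div_max hN hr] at hF ⊢
  rw [F_eq_div_max hM hp]
  set x := max M p
  set y := max N r
  have hx : 0 < x := hM.trans_le (le_max_left _ _)
  have hy : 0 < y := hN.trans_le (le_max_left _ _)
  have hxy : |y - x| ≤ |M - N| + |r - p| := by
    refine (abs_max_sub_max_le_max N r M p).trans ?_
    rw [abs_sub_comm N M]
    exact max_le_add_of_nonneg (abs_nonneg _) (abs_nonneg _)
  have hdiff : M / x - N / y = ((M - N) + N / y * (y - x)) / x := by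
    field_simp
    ring
  have hnum : |(M - N) + N / y * (y - x)| ≤ |M - N| + N / y * (|M - N| + |r - p|) := by
    refine (abs_add_le _ _).trans ?_
    rw [abs_mul, abs_of_nonneg hF]
    gcongr
  rw [hdiff, abs_div, abs_of_pos hx, div_mul_eq_mul_div, div_le_iff₀ hx]
  exact mul_le_mul hnum (le_max_right _ _) hp ((abs_nonneg _).trans hnum)

theorem abs_F_sub_F_mul_mul_le (hM : 0 < M) (hN : 0 < N) (hp : 0 ≤ p) (hr : 0 ≤ r) :
    |F M p - F N r| * p * r ≤ 2 * |M - N| * r + N * |r - p| := by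
  calc |F M p - F N r| * p * r ≤ (|M - N| + F N r * (|M - N| + |r - p|)) * r := by
        gcongr
        exact abs_F_sub_F_mul_le hM hN hp hr
    _ = |M - N| * r + F N r * (|M - N| * r) + F N r * r * |r - p| := by ring
    _ ≤ |M - N| * r + 1 * (|M - N| * r) + N * |r - p| := by
        gcongr
        exacts [F_le_one N r, F_mul_le hN hr]
    _ = 2 * |M - N| * r + N * |r - p| := by ring

theorem abs_F_rpow_sub_F_rpow_mul_le {s : ℝ} (hs₀ : 0 ≤ s) (hs₂ : s ≤ 2) (hM : 0 < M) (hN : 0 < N)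
    (hp : 0 ≤ p) (hpr : p ≤ r) :
    |F M (p ^ s) - F N (r ^ s)| * (p ^ s * p) ≤ 2 * |M - N| * p + 2 * N * (r - p) := by
  have hr := hp.trans hpr
  have hrs := Real.rpow_nonneg hr s
  have hF := F_nonneg hN hrs
  have hpow : 0 ≤ r ^ s - p ^ s := sub_nonneg.2 (Real.rpow_le_rpow hp hpr hs₀)
  have hdiff : (r ^ s - p ^ s) * p ≤ 2 * r ^ s * (r - p) := by
    calc (r ^ s - p ^ s) * p ≤ (r ^ s - p ^ s) * r := by gcongr
      _ = r * (r ^ s - p ^ s) := mul_comm _ _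
      _ ≤ 2 * r ^ s * (r - p) := mul_rpow_sub_rpow_le hs₀ hs₂ hp hpr
  calc |F M (p ^ s) - F N (r ^ s)| * (p ^ s * p)
      = |F M (p ^ s) - F N (r ^ s)| * p ^ s * p := by ring
    _ ≤ (|M - N| + F N (r ^ s) * (|M - N| + |r ^ s - p ^ s|)) * p := by
        gcongr
        exact abs_F_sub_F_mul_le hM hN (Real.rpow_nonneg hp s) hrs
    _ = |M - N| * p + F N (r ^ s) * (|M - N| * p) + F N (r ^ s) * ((r ^ s - p ^ s) * p) := by
        rw [abs_of_nonneg hpow]; ring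
    _ ≤ |M - N| * p + 1 * (|M - N| * p) + F N (r ^ s) * (2 * r ^ s * (r - p)) := by
        gcongr
        exact F_le_one N _
    _ = 2 * |M - N| * p + F N (r ^ s) * r ^ s * (2 * (r - p)) := by ring
    _ ≤ 2 * |M - N| * p + N * (2 * (r - p)) := by
        have : 0 ≤ r - p := sub_nonneg.2 hpr
        gcongr
        exact F_mul_le hN hrs
    _ = 2 * |M - N| * p + 2 * N * (r - p) := by ring

end Cutoff

/-! ### Differences of the nonlinear terms -/

theorem normV_sub_comm (U W : V Ω) : normV (U - W) = normV (W - U) :=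
  norm_sub_rev (gradV U) (gradV W)

theorem abs_normV_sub_normV_le (U W : V Ω) : |normV U - normV W| ≤ normV (U - W) :=
  abs_norm_sub_norm_le (gradV U) (gradV W)

section Difference

variable {K M N β : ℝ}

namespace IsSobolevConst

theorem mul_b_sub_mul_b_eq (hK : IsSobolevConst Ω K) (c d : ℝ) (U W : V Ω) :
    c * b W W (W - U) - d * b U U (W - U) =
      c * b (W - U) W (W - U) + (c - d) * b U W (W - U) := by
  have hleft : b W W (W - U) = b (W - U) W (W - U) + b U W (W - U) := by
    rw [← hK.b_add_left, sub_add_cancel]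
  have hmiddle : b U W (W - U) = b U U (W - U) := by
    calc b U W (W - U) = b U (U + (W - U)) (W - U) := by rw [add_sub_cancel]
      _ = b U U (W - U) := by rw [hK.b_add_middle, hK.b_self_eq_zero, add_zero]
  rw [hleft, ← hmiddle]
  ring

theorem abs_F_mul_b_sub_F_mul_b_le (hK : IsSobolevConst Ω K) (hM : 0 < M) (hN : 0 < N)
    (U W : V Ω) :
    |F M (normV W) * b W W (W - U) - F N (normV U) * b U U (W - U)| ≤
      K ^ 2 * (√‖fieldV (W - U)‖ * √(normV (W - U))) *
        ((M + N) * normV (W - U) + 2 * (|M - N| * normV U)) := by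
  have hU := normV_nonneg U
  have hW := normV_nonneg W
  have hZ := normV_nonneg (W - U)
  have hF := F_nonneg hM hW
  set q := √‖fieldV (W - U)‖ * √(normV (W - U))
  have hfirst : |F M (normV W) * b (W - U) W (W - U)| ≤ K ^ 2 * q * (M * normV (W - U)) := by
    rw [abs_mul, abs_of_nonneg hF]
    calc F M (normV W) * |b (W - U) W (W - U)|
        ≤ F M (normV W) * (K ^ 2 * normV (W - U) * normV W * q) := by
          gcongr
          exact hK.abs_b_le_mul_sqrt _ _ _
      _ = K ^ 2 * q * (F M (normV W) * normV W * normV (W - U)) := by ring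
      _ ≤ K ^ 2 * q * (M * normV (W - U)) := by
          gcongr
          exact F_mul_le hM hW
  have hsecond : |(F M (normV W) - F N (normV U)) * b U W (W - U)| ≤
      K ^ 2 * q * (2 * |M - N| * normV U + N * normV (W - U)) := by
    rw [abs_mul]
    calc |F M (normV W) - F N (normV U)| * |b U W (W - U)|
        ≤ |F M (normV W) - F N (normV U)| * (K ^ 2 * normV U * normV W * q) := by
          gcongr
          exact hK.abs_b_le_mul_sqrt _ _ _
      _ = K ^ 2 * q * (|F M (normV W) - F N (normV U)| * normV W * normV U) := by ring
      _ ≤ K ^ 2 * q * (2 * |M - N| * normV U + N * normV (W - U)) := by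
          gcongr
          refine (abs_F_sub_F_mul_mul_le hM hN hW hU).trans ?_
          rw [normV_sub_comm W U]
          gcongr
          exact abs_normV_sub_normV_le U W
  rw [hK.mul_b_sub_mul_b_eq]
  calc _ ≤ K ^ 2 * q * (M * normV (W - U)) +
        K ^ 2 * q * (2 * |M - N| * normV U + N * normV (W - U)) :=
        (abs_add_le _ _).trans (add_le_add hfirst hsecond)
    _ = _ := by ring

theorem damping_neg_right (hK : IsSobolevConst Ω K) (hβ₁ : 1 ≤ β) (hβ₃ : β ≤ 3) (U Z : V Ω) :
    damping β U (-Z) = -damping β U Z := by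
  simp only [hK.damping_eq_inner hβ₁ hβ₃]
  exact inner_neg_right _ _

theorem le_F_mul_damping_sub_of_normV_le (hK : IsSobolevConst Ω K) (hβ₁ : 1 ≤ β) (hβ₃ : β ≤ 3)
    (hM : 0 < M) (hN : 0 < N) {U W : V Ω} (hUW : normV U ≤ normV W) :
    -(K ^ 4 * ‖fieldV (W - U)‖ * (2 * (|M - N| * normV U) + 2 * N * normV (W - U))) ≤
      F N (normV W ^ (β - 1)) * damping β W (W - U) -
        F M (normV U ^ (β - 1)) * damping β U (W - U) := by
  have hU := normV_nonneg U
  set p := normV U ^ (β - 1)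
  set r := normV W ^ (β - 1)
  have hmono : 0 ≤ F N r * (damping β W (W - U) - damping β U (W - U)) :=
    mul_nonneg (F_nonneg hN (Real.rpow_nonneg (normV_nonneg W) _))
      (hK.damping_sub_nonneg hβ₁ hβ₃ W U)
  -- The difference of the cutoffs is put on the damping of the field with the smaller norm, the
  -- only one that `abs_F_rpow_sub_F_rpow_mul_le` controls.
  have hcutoff : |(F M p - F N r) * damping β U (W - U)| ≤
      K ^ 4 * ‖fieldV (W - U)‖ * (2 * (|M - N| * normV U) + 2 * N * normV (W - U)) := by
    rw [abs_mul]
    calc |F M p - F N r| * |damping β U (W - U)|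
        ≤ |F M p - F N r| * (K ^ 4 * (p * normV U) * ‖fieldV (W - U)‖) := by
          gcongr
          exact hK.abs_damping_le hβ₁ hβ₃ U _
      _ = K ^ 4 * ‖fieldV (W - U)‖ * (|F M p - F N r| * (p * normV U)) := by ring
      _ ≤ K ^ 4 * ‖fieldV (W - U)‖ *
          (2 * |M - N| * normV U + 2 * N * (normV W - normV U)) := by
          gcongr
          exact abs_F_rpow_sub_F_rpow_mul_le (by linarith) (by linarith) hM hN hU hUW
      _ ≤ K ^ 4 * ‖fieldV (W - U)‖ *
          (2 * (|M - N| * normV U) + 2 * N * normV (W - U)) := by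
          rw [mul_assoc 2 |M - N|]
          gcongr
          exact (le_abs_self _).trans (abs_normV_sub_normV_le W U)
  linarith [le_abs_self ((F M p - F N r) * damping β U (W - U))]

theorem le_F_mul_damping_sub (hK : IsSobolevConst Ω K) (hβ₁ : 1 ≤ β) (hβ₃ : β ≤ 3) (hM : 0 < M)
    (hN : 0 < N) (U W : V Ω) :
    -(K ^ 4 * ‖fieldV (W - U)‖ * (2 * (|M - N| * normV U) + 2 * (M + N) * normV (W - U))) ≤
      F M (normV W ^ (β - 1)) * damping β W (W - U) -
        F N (normV U ^ (β - 1)) * damping β U (W - U) := by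
  have hZ := normV_nonneg (W - U)
  rcases le_total (normV U) (normV W) with h | h
  · refine le_trans ?_ (hK.le_F_mul_damping_sub_of_normV_le hβ₁ hβ₃ hN hM h)
    rw [abs_sub_comm N M]
    gcongr
    linarith
  · have hbound := hK.le_F_mul_damping_sub_of_normV_le hβ₁ hβ₃ hM hN h
    have hnorm : ‖fieldV (U - W)‖ = ‖fieldV (W - U)‖ := norm_sub_rev (fieldV U) (fieldV W)
    rw [hnorm, normV_sub_comm U W, ← neg_sub W U, hK.damping_neg_right hβ₁ hβ₃,
      hK.damping_neg_right hβ₁ hβ₃] at hbound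
    calc _ ≤ -(K ^ 4 * ‖fieldV (W - U)‖ *
          (2 * (|M - N| * normV W) + 2 * N * normV (W - U))) := by
          gcongr
          linarith
      _ ≤ _ := by linarith

end IsSobolevConst

end Difference

section Absorption

variable {μ x y : ℝ}

theorem mul_le_quarter_mul_sq_add_sq_div (hμ : 0 < μ) (x y : ℝ) :
    x * y ≤ μ / 4 * x ^ 2 + y ^ 2 / μ := by
  have hsq : 0 ≤ (μ * x - 2 * y) ^ 2 / (4 * μ) := by positivity
  have hexpand : (μ * x - 2 * y) ^ 2 / (4 * μ) = μ / 4 * x ^ 2 + y ^ 2 / μ - x * y := by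
    field_simp
    ring
  linarith

theorem convection_absorption (hμ : 0 < μ) {q : ℝ} (hq : q ^ 2 = x * y) (a L e : ℝ) :
    a * q * (L * x + 2 * e) ≤
      3 * μ / 4 * x ^ 2 + (a ^ 4 * L ^ 4 / μ ^ 3 + a ^ 4 / μ) * y ^ 2 + e ^ 2 := by
  have hlinear : x * (a * L * q) ≤ μ / 4 * x ^ 2 + x * (a ^ 2 * L ^ 2 * y / μ) := by
    refine (mul_le_quarter_mul_sq_add_sq_div hμ x (a * L * q)).trans_eq ?_
    rw [mul_pow, hq]
    ring
  have hquartic : x * (a ^ 2 * L ^ 2 * y / μ) ≤ μ / 4 * x ^ 2 + a ^ 4 * L ^ 4 / μ ^ 3 * y ^ 2 := by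
    refine (mul_le_quarter_mul_sq_add_sq_div hμ x _).trans_eq ?_
    field_simp
  have hdata : 2 * (a * q) * e ≤ x * (a ^ 2 * y) + e ^ 2 := by
    have : (a * q) ^ 2 = x * (a ^ 2 * y) := by rw [mul_pow, hq]; ring
    linarith [two_mul_le_add_sq (a * q) e]
  have hsquare : x * (a ^ 2 * y) ≤ μ / 4 * x ^ 2 + a ^ 4 / μ * y ^ 2 := by
    refine (mul_le_quarter_mul_sq_add_sq_div hμ x _).trans_eq ?_
    ring
  linarith

theorem damping_absorption (hμ : 0 < μ) (x y c L e : ℝ) :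
    c * y * (2 * e + 2 * L * x) ≤
      μ / 4 * x ^ 2 + (4 * c ^ 2 * L ^ 2 / μ + c ^ 2) * y ^ 2 + e ^ 2 := by
  have hyoung : x * (2 * c * L * y) ≤ μ / 4 * x ^ 2 + 4 * c ^ 2 * L ^ 2 / μ * y ^ 2 := by
    refine (mul_le_quarter_mul_sq_add_sq_div hμ x _).trans_eq ?_
    ring
  linarith [two_mul_le_add_sq (c * y) e]

end Absorption

/-! ### The spatial operator -/

/-- The growth rate `γ(M, N)` in the continuous dependence estimate: twice the coefficient of
`|v - u|²` left after absorbing all gradient terms by the viscosity. -/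
noncomputable def rate (K μ α M N : ℝ) : ℝ :=
  2 * (K ^ 8 * (M + N) ^ 4 / μ ^ 3 + K ^ 8 / μ + 4 * α ^ 2 * K ^ 8 * (M + N) ^ 2 / μ
    + α ^ 2 * K ^ 8 + 1 / 2)

theorem rate_pos {K μ α M N : ℝ} (hμ : 0 < μ) : 0 < rate K μ α M N := by
  unfold rate
  positivity

theorem rate_mono_left {K μ α M M' N : ℝ} (hμ : 0 < μ) (hM : 0 ≤ M) (hN : 0 ≤ N) (h : M ≤ M') :
    rate K μ α M N ≤ rate K μ α M' N := by
  unfold rate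
  gcongr

/-- The Stokes operator `u ↦ ((u, ·))`. -/
noncomputable def stokes (U : V Ω) : VDual Ω := (innerSL ℝ (gradL U)).comp gradL

theorem continuous_stokes : Continuous (stokes : V Ω → VDual Ω) :=
  ((innerSL ℝ).continuous.comp gradL.continuous).clm_comp continuous_const

theorem stokes_apply (U Z : V Ω) : stokes U Z = innerV U Z := rfl

theorem abs_innerV_le (U Z : V Ω) : |innerV U Z| ≤ ‖U‖ * ‖Z‖ :=
  (abs_real_inner_le_norm (gradV U) (gradV Z)).trans
    (mul_le_mul (normV_le_norm U) (normV_le_norm Z) (normV_nonneg Z) (norm_nonneg U))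

namespace IsSobolevConst

variable {K β μ α M N : ℝ} (hK : IsSobolevConst Ω K) (hβ₁ : 1 ≤ β) (hβ₃ : β ≤ 3)

include hK in
theorem abs_F_mul_b_le (hN : 0 < N) (U Z : V Ω) :
    |F N (normV U) * b U U Z| ≤ K ^ 2 * N * (‖U‖ * ‖Z‖) := by
  have hU := normV_nonneg U
  have hZ := normV_nonneg Z
  have hF := F_nonneg hN hU
  rw [abs_mul, abs_of_nonneg hF]
  calc F N (normV U) * |b U U Z| ≤ F N (normV U) * (K ^ 2 * normV U * normV U * normV Z) := by
        gcongr
        exact hK.abs_b_le U U Z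
    _ = K ^ 2 * (F N (normV U) * normV U) * (normV U * normV Z) := by ring
    _ ≤ K ^ 2 * N * (‖U‖ * ‖Z‖) := by
        gcongr
        exacts [F_mul_le hN hU, normV_le_norm U, normV_le_norm Z]

include hK hβ₁ hβ₃ in
theorem abs_F_mul_damping_le (hN : 0 < N) (U Z : V Ω) :
    |F N (normV U ^ (β - 1)) * damping β U Z| ≤ K ^ 4 * N * (‖U‖ * ‖Z‖) := by
  have hU := normV_nonneg U
  have hpow := Real.rpow_nonneg hU (β - 1)
  have hF := F_nonneg hN hpow
  rw [abs_mul, abs_of_nonneg hF]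
  calc F N (normV U ^ (β - 1)) * |damping β U Z|
      ≤ F N (normV U ^ (β - 1)) * (K ^ 4 * (normV U ^ (β - 1) * normV U) * ‖fieldV Z‖) := by
        gcongr
        exact hK.abs_damping_le hβ₁ hβ₃ U Z
    _ = K ^ 4 * (F N (normV U ^ (β - 1)) * normV U ^ (β - 1)) * (normV U * ‖fieldV Z‖) := by ring
    _ ≤ K ^ 4 * N * (‖U‖ * ‖Z‖) := by
        gcongr
        exacts [F_mul_le hN hpow, normV_le_norm U, norm_fieldV_le_norm Z]

/-- The damping `|u|^{β - 1} u` as an element of `V'`. -/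
noncomputable def dampDual (U : V Ω) : VDual Ω := (innerSL ℝ (hK.dampL2 hβ₁ hβ₃ U)).comp fieldL

theorem dampDual_apply (U Z : V Ω) : hK.dampDual hβ₁ hβ₃ U Z = damping β U Z :=
  (hK.damping_eq_inner hβ₁ hβ₃ U Z).symm

theorem continuous_dampDual : Continuous (hK.dampDual hβ₁ hβ₃) :=
  ((innerSL ℝ).continuous.comp (hK.continuous_dampL2 hβ₁ hβ₃)).clm_comp continuous_const

/-- The spatial part `μ A u + F_N(‖u‖) B(u, u) + α F_N(‖u‖^{β - 1}) |u|^{β - 1} u` of the equation,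
as an element of `V'`. -/
noncomputable def opDual (μ α N : ℝ) (U : V Ω) : VDual Ω :=
  μ • stokes U + F N (normV U) • hK.bDual U U
    + (α * F N (normV U ^ (β - 1))) • hK.dampDual hβ₁ hβ₃ U

theorem opDual_apply (μ α N : ℝ) (U Z : V Ω) : hK.opDual hβ₁ hβ₃ μ α N U Z =
    μ * innerV U Z + F N (normV U) * b U U Z
      + α * (F N (normV U ^ (β - 1)) * damping β U Z) := by
  rw [← stokes_apply, ← hK.bDual_apply, ← hK.dampDual_apply hβ₁ hβ₃, ← mul_assoc α]
  rfl

theorem norm_opDual_le (hμ : 0 ≤ μ) (hα : 0 ≤ α) (hN : 0 < N) (U : V Ω) :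
    ‖hK.opDual hβ₁ hβ₃ μ α N U‖ ≤ (μ + K ^ 2 * N + α * (K ^ 4 * N)) * ‖U‖ := by
  refine ContinuousLinearMap.opNorm_le_bound _ (by positivity) fun Z => ?_
  rw [opDual_apply, Real.norm_eq_abs]
  calc _ ≤ |μ * innerV U Z| + |F N (normV U) * b U U Z|
        + |α * (F N (normV U ^ (β - 1)) * damping β U Z)| := abs_add_three _ _ _
    _ ≤ μ * (‖U‖ * ‖Z‖) + K ^ 2 * N * (‖U‖ * ‖Z‖) + α * (K ^ 4 * N * (‖U‖ * ‖Z‖)) := by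
        rw [abs_mul μ, abs_mul α, abs_of_nonneg hμ, abs_of_nonneg hα]
        gcongr
        exacts [abs_innerV_le U Z, hK.abs_F_mul_b_le hN U Z,
          hK.abs_F_mul_damping_le hβ₁ hβ₃ hN U Z]
    _ = (μ + K ^ 2 * N + α * (K ^ 4 * N)) * ‖U‖ * ‖Z‖ := by ring

theorem aestronglyMeasurable_opDual (μ α N : ℝ) {X : Type*} [MeasurableSpace X] {ν : Measure X}
    {U : X → V Ω} (hU : AEStronglyMeasurable U ν) :
    AEStronglyMeasurable (fun t => hK.opDual hβ₁ hβ₃ μ α N (U t)) ν := by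
  have hnorm : AEMeasurable (fun t => normV (U t)) ν :=
    (continuous_normV.comp_aestronglyMeasurable hU).aemeasurable
  have hconvection : AEStronglyMeasurable (fun t => F N (normV (U t)) • hK.bDual (U t) (U t)) ν :=
    ((measurable_F N).comp_aemeasurable hnorm).aestronglyMeasurable.smul
      (hK.continuous_bDual_self.comp_aestronglyMeasurable hU)
  have hdamping : AEStronglyMeasurable
      (fun t => (α * F N (normV (U t) ^ (β - 1))) • hK.dampDual hβ₁ hβ₃ (U t)) ν :=
    (((measurable_F N).comp_aemeasurable (hnorm.pow_const (β - 1))).const_mul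
      α).aestronglyMeasurable.smul ((hK.continuous_dampDual hβ₁ hβ₃).comp_aestronglyMeasurable hU)
  exact (((continuous_stokes.comp_aestronglyMeasurable hU).const_smul μ).add hconvection).add
    hdamping

theorem inner_sub_opDual_sub_le (hμ : 0 < μ) (hα : 0 ≤ α) (hM : 0 < M) (hN : 0 < N) (U W : V Ω)
    (g : L2 Ω) :
    2 * (⟪g, fieldV (W - U)⟫ - (hK.opDual hβ₁ hβ₃ μ α M W (W - U)
        - hK.opDual hβ₁ hβ₃ μ α N U (W - U))) ≤
      rate K μ α M N * ‖fieldV (W - U)‖ ^ 2 + 4 * |M - N| ^ 2 * normV U ^ 2 + ‖g‖ ^ 2 := by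
  have hviscosity : innerV W (W - U) - innerV U (W - U) = normV (W - U) ^ 2 := by
    rw [innerV, innerV, ← inner_sub_left, normV, ← real_inner_self_eq_norm_sq]
    rfl
  have hconvection := neg_le_of_abs_le (hK.abs_F_mul_b_sub_F_mul_b_le hM hN U W)
  have hdamping := mul_le_mul_of_nonneg_left (hK.le_F_mul_damping_sub hβ₁ hβ₃ hM hN U W) hα
  have hforcing : ⟪g, fieldV (W - U)⟫ ≤ ‖g‖ * ‖fieldV (W - U)‖ := real_inner_le_norm _ _
  have hq : (√‖fieldV (W - U)‖ * √(normV (W - U))) ^ 2 = normV (W - U) * ‖fieldV (W - U)‖ := by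
    rw [mul_pow, Real.sq_sqrt (norm_nonneg _), Real.sq_sqrt (normV_nonneg _), mul_comm]
  have habsorb_convection := convection_absorption hμ hq (K ^ 2) (M + N) (|M - N| * normV U)
  have habsorb_damping := damping_absorption hμ (normV (W - U)) ‖fieldV (W - U)‖ (α * K ^ 4)
    (M + N) (|M - N| * normV U)
  have habsorb_forcing := two_mul_le_add_sq ‖g‖ ‖fieldV (W - U)‖
  rw [opDual_apply, opDual_apply, rate]
  linear_combination 2 * hforcing + 2 * hconvection + 2 * hdamping + 2 * habsorb_convection +
    2 * habsorb_damping + habsorb_forcing - 2 * μ * hviscosity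

end IsSobolevConst

/-! ### Time regularity of weak solutions -/

section MonotoneIntegral

variable {τ T s t : ℝ} {h : ℝ → ℝ}

theorem intervalIntegrable_of_integrableOn_Ioc (hh : IntegrableOn h (Ioc τ T)) (hs : τ ≤ s)
    (ht : s ≤ T) : IntervalIntegrable h volume τ s :=
  (intervalIntegrable_iff_integrableOn_Ioc_of_le hs).2 (hh.mono_set (Ioc_subset_Ioc_right ht))

theorem integral_le_integral_of_nonneg (hh : IntegrableOn h (Ioc τ T)) (h₀ : ∀ r, 0 ≤ h r)
    (hs : τ ≤ s) (hst : s ≤ t) (ht : t ≤ T) : ∫ r in τ..s, h r ≤ ∫ r in τ..t, h r :=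
  intervalIntegral.integral_mono_interval le_rfl hs hst (Eventually.of_forall h₀)
    (intervalIntegrable_of_integrableOn_Ioc hh (hs.trans hst) ht)

end MonotoneIntegral

theorem fieldV_toV {x : H Ω} (hx : MemV x) : fieldV (toV x) = (x : L2 Ω) := by
  rw [toV, dif_pos hx]
  exact hx.choose_spec

variable {K μ α β N M τ T : ℝ} {f : ℝ → VDual Ω} {u₀ : H Ω} {u : ℝ → H Ω}

/-- The time derivative `f - μ A u - F_N(‖u‖) B(u, u) - α F_N(‖u‖^{β - 1}) |u|^{β - 1} u` that the
equation prescribes for `u`, as an element of `V'`. -/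
noncomputable def timeDeriv (hK : IsSobolevConst Ω K) (hβ₁ : 1 ≤ β) (hβ₃ : β ≤ 3) (μ α N : ℝ)
    (f : ℝ → VDual Ω) (u : ℝ → H Ω) (t : ℝ) : VDual Ω :=
  f t - hK.opDual hβ₁ hβ₃ μ α N (toV (u t))

namespace IsWeakSolution

theorem integrableOn_normV_sq (hu : IsWeakSolution μ α β N τ T f u₀ u) :
    IntegrableOn (fun t => normV (toV (u t)) ^ 2) (Ioc τ T) :=
  (MemLp.of_le hu.memLp_V
    (continuous_normV.comp_aestronglyMeasurable hu.memLp_V.aestronglyMeasurable)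
    (Eventually.of_forall fun t => by
      rw [Real.norm_of_nonneg (normV_nonneg _)]
      exact normV_le_norm _)).integrable_sq

theorem memLp_opDual (hu : IsWeakSolution μ α β N τ T f u₀ u) (hK : IsSobolevConst Ω K)
    (hβ₁ : 1 ≤ β) (hβ₃ : β ≤ 3) (hμ : 0 ≤ μ) (hα : 0 ≤ α) (hN : 0 < N) :
    MemLp (fun t => hK.opDual hβ₁ hβ₃ μ α N (toV (u t))) 2 (volume.restrict (Ioc τ T)) :=
  MemLp.of_le_mul (E := VDual Ω) (F := V Ω) hu.memLp_V
    (hK.aestronglyMeasurable_opDual hβ₁ hβ₃ μ α N hu.memLp_V.aestronglyMeasurable)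
    (Eventually.of_forall fun t => hK.norm_opDual_le hβ₁ hβ₃ hμ hα hN (toV (u t)))

theorem memLp_timeDeriv (hu : IsWeakSolution μ α β N τ T f u₀ u) (hK : IsSobolevConst Ω K)
    (hβ₁ : 1 ≤ β) (hβ₃ : β ≤ 3) (hμ : 0 ≤ μ) (hα : 0 ≤ α) (hN : 0 < N) :
    MemLp (timeDeriv hK hβ₁ hβ₃ μ α N f u) 2 (volume.restrict (Ioc τ T)) :=
  MemLp.sub (E := VDual Ω) hu.forcing (hu.memLp_opDual hK hβ₁ hβ₃ hμ hα hN)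

theorem hasWeakDerivOn_inner (hu : IsWeakSolution μ α β N τ T f u₀ u) (hτT : τ ≤ T)
    (hK : IsSobolevConst Ω K) (hβ₁ : 1 ≤ β) (hβ₃ : β ≤ 3) (hμ : 0 ≤ μ) (hα : 0 ≤ α) (hN : 0 < N)
    (φ : V Ω) :
    HasWeakDerivOn (fun t => ⟪u t, inclH φ⟫) (fun t => timeDeriv hK hβ₁ hβ₃ μ α N f u t φ) τ T := by
  intro ψ hψ
  have hφ : MemLp (fieldV φ) (ENNReal.ofReal (β + 1)) (volume.restrict Ω) :=
    hK.memLp (ENNReal.one_le_ofReal.2 (by linarith)) (ENNReal.ofReal_le_ofNat.2 (by linarith)) φ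
  have hequation := hu.equation φ hφ ψ hψ.smooth hψ.compact_support hψ.support_subset
  have hf := (intervalIntegrable_dual_apply hτT hu.forcing φ).mul_continuousOn
    hψ.smooth.continuous.continuousOn
  have hop := (intervalIntegrable_dual_apply hτT
    (hu.memLp_opDual hK hβ₁ hβ₃ hμ hα hN) φ).mul_continuousOn hψ.smooth.continuous.continuousOn
  simp_rw [← hK.opDual_apply hβ₁ hβ₃] at hequation
  simp only [Submodule.coe_inner, coe_inclH, timeDeriv, sub_apply, sub_mul]
  rw [intervalIntegral.integral_sub hf hop]
  linarith

end IsWeakSolution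

/-! ### Continuous dependence -/

section Dependence

variable {K μ α β N M τ T : ℝ} {fu fv : ℝ → VDual Ω} {g : ℝ → H Ω} {uτ vτ : H Ω} {u v : ℝ → H Ω}

namespace IsWeakSolution

theorem energy_inequality_sub (hu : IsWeakSolution μ α β N τ T fu uτ u)
    (hv : IsWeakSolution μ α β M τ T fv vτ v) (hτT : τ < T) (hK : IsSobolevConst Ω K)
    (hβ₁ : 1 ≤ β) (hβ₃ : β ≤ 3) (hμ : 0 ≤ μ) (hα : 0 ≤ α) (hM : 0 < M) (hN : 0 < N) {t : ℝ}
    (ht : t ∈ Icc τ T) :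
    ‖v t - u t‖ ^ 2 ≤ ‖vτ - uτ‖ ^ 2 + 2 * ∫ s in τ..t,
      (timeDeriv hK hβ₁ hβ₃ μ α M fv v s - timeDeriv hK hβ₁ hβ₃ μ α N fu u s)
        (toV (v s) - toV (u s)) := by
  have hGu := hu.memLp_timeDeriv hK hβ₁ hβ₃ hμ hα hN
  have hGv := hv.memLp_timeDeriv hK hβ₁ hβ₃ hμ hα hM
  rw [← hu.initial, ← hv.initial]
  refine energy_inequality (J := inclH) (w := fun s => v s - u s)
    (W := fun s => toV (v s) - toV (u s)) hτT (fun e => ?_) (hv.memLp_V.sub hu.memLp_V)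
    (MemLp.sub (E := VDual Ω) hGv hGu) ?_ (fun φ => ?_) ht
  · simp_rw [inner_sub_left]
    exact (hv.weakly_continuous e).sub (hu.weakly_continuous e)
  · filter_upwards [hu.memV, hv.memV] with s hus hvs
    refine Subtype.ext ?_
    rw [map_sub, Submodule.coe_sub, Submodule.coe_sub, coe_inclH, coe_inclH, fieldV_toV hus,
      fieldV_toV hvs]
  · simp_rw [inner_sub_left]
    exact (hv.hasWeakDerivOn_inner hτT.le hK hβ₁ hβ₃ hμ hα hM φ).sub
      (hu.hasWeakDerivOn_inner hτT.le hK hβ₁ hβ₃ hμ hα hN φ) hτT.le (hv.weakly_continuous _)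
      (hu.weakly_continuous _) (intervalIntegrable_dual_apply hτT.le hGv φ)
      (intervalIntegrable_dual_apply hτT.le hGu φ)

theorem ae_timeDeriv_sub_apply_le (hu : IsWeakSolution μ α β N τ T fu uτ u)
    (hv : IsWeakSolution μ α β M τ T fv vτ v) (hg : ForcingDiff τ T fu fv g)
    (hK : IsSobolevConst Ω K) (hβ₁ : 1 ≤ β) (hβ₃ : β ≤ 3) (hμ : 0 < μ) (hα : 0 ≤ α) (hM : 0 < M)
    (hN : 0 < N) :
    ∀ᵐ s ∂volume.restrict (Ioc τ T),
      2 * (timeDeriv hK hβ₁ hβ₃ μ α M fv v s - timeDeriv hK hβ₁ hβ₃ μ α N fu u s)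
          (toV (v s) - toV (u s)) ≤
        rate K μ α M N * ‖v s - u s‖ ^ 2 + 4 * |M - N| ^ 2 * normV (toV (u s)) ^ 2
          + ‖g s‖ ^ 2 := by
  filter_upwards [hu.memV, hv.memV, hg.2] with s hus hvs hgs
  have hfield : fieldV (toV (v s) - toV (u s)) = (v s - u s : L2 Ω) := by
    rw [← fieldV_toV hus, ← fieldV_toV hvs]
    rfl
  have hforcing : fv s (toV (v s) - toV (u s)) - fu s (toV (v s) - toV (u s)) =
      ⟪(g s : L2 Ω), fieldV (toV (v s) - toV (u s))⟫ := by
    rw [← sub_apply, hgs]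
    rfl
  have hbound := hK.inner_sub_opDual_sub_le hβ₁ hβ₃ hμ hα hM hN (toV (u s)) (toV (v s)) (g s)
  rw [← hforcing, hfield] at hbound
  refine le_trans (le_of_eq ?_) hbound
  simp only [timeDeriv, sub_apply]
  ring

theorem integrableOn_norm_sub_sq (hu : IsWeakSolution μ α β N τ T fu uτ u)
    (hv : IsWeakSolution μ α β M τ T fv vτ v) :
    IntegrableOn (fun s => ‖v s - u s‖ ^ 2) (Ioc τ T) :=
  (MemLp.mono_exponent (hv.memLp_top.sub hu.memLp_top) le_top).integrable_norm_pow two_ne_zero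

theorem norm_sub_sq_le_add_integral (hu : IsWeakSolution μ α β N τ T fu uτ u)
    (hv : IsWeakSolution μ α β M τ T fv vτ v) (hτT : τ < T) (hg : ForcingDiff τ T fu fv g)
    (hK : IsSobolevConst Ω K) (hβ₁ : 1 ≤ β) (hβ₃ : β ≤ 3) (hμ : 0 < μ) (hα : 0 ≤ α) (hM : 0 < M)
    (hN : 0 < N) {t : ℝ} (ht : t ∈ Icc τ T) :
    ‖v t - u t‖ ^ 2 ≤ ‖vτ - uτ‖ ^ 2 + 4 * |M - N| ^ 2 * (∫ s in τ..t, normV (toV (u s)) ^ 2)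
        + (∫ s in τ..t, ‖g s‖ ^ 2) + rate K μ α M N * ∫ s in τ..t, ‖v s - u s‖ ^ 2 := by
  have hdiff := (intervalIntegrable_of_integrableOn_Ioc (hu.integrableOn_norm_sub_sq hv) ht.1
    ht.2).const_mul (rate K μ α M N)
  have hgrad := (intervalIntegrable_of_integrableOn_Ioc hu.integrableOn_normV_sq ht.1
    ht.2).const_mul (4 * |M - N| ^ 2)
  have hforcing := intervalIntegrable_of_integrableOn_Ioc
    (hg.1.integrable_norm_pow two_ne_zero) ht.1 ht.2
  have hpairing := intervalIntegrable_of_integrableOn_Ioc ((integrable_dual_apply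
    (MemLp.sub (E := VDual Ω) (hv.memLp_timeDeriv hK hβ₁ hβ₃ hμ.le hα hM)
      (hu.memLp_timeDeriv hK hβ₁ hβ₃ hμ.le hα hN))
    (hv.memLp_V.sub hu.memLp_V)).const_mul 2) ht.1 ht.2
  have hle := intervalIntegral.integral_mono_ae_restrict ht.1 hpairing
    ((hdiff.add hgrad).add hforcing) (by
      rw [Measure.restrict_congr_set Ioc_ae_eq_Icc.symm]
      exact ae_mono (Measure.restrict_mono (Ioc_subset_Ioc_right ht.2) le_rfl)
        (hu.ae_timeDeriv_sub_apply_le hv hg hK hβ₁ hβ₃ hμ hα hM hN))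
  have henergy := hu.energy_inequality_sub hv hτT hK hβ₁ hβ₃ hμ.le hα hM hN ht
  rw [← intervalIntegral.integral_const_mul] at henergy
  refine (henergy.trans (add_le_add_right hle _)).trans_eq ?_
  rw [intervalIntegral.integral_add (hdiff.add hgrad) hforcing,
    intervalIntegral.integral_add hdiff hgrad]
  simp only [intervalIntegral.integral_const_mul]
  ring

theorem norm_sub_sq_le (hu : IsWeakSolution μ α β N τ T fu uτ u)
    (hv : IsWeakSolution μ α β M τ T fv vτ v) (hτT : τ < T) (hg : ForcingDiff τ T fu fv g)
    (hK : IsSobolevConst Ω K) (hβ₁ : 1 ≤ β) (hβ₃ : β ≤ 3) (hμ : 0 < μ) (hα : 0 ≤ α) (hM : 0 < M)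
    (hN : 0 < N) {t : ℝ} (ht : t ∈ Icc τ T) :
    ‖v t - u t‖ ^ 2 ≤ 4 * Real.exp (rate K μ α M N * (t - τ)) *
      (‖vτ - uτ‖ ^ 2 + (∫ s in τ..t, normV (toV (u s)) ^ 2) * |M - N| ^ 2
        + ∫ s in τ..t, ‖g s‖ ^ 2) := by
  have hforcing_nonneg : 0 ≤ ∫ s in τ..t, ‖g s‖ ^ 2 :=
    intervalIntegral.integral_nonneg ht.1 fun _ _ => sq_nonneg _
  have hgronwall := le_mul_exp_of_le_add_integral
    (A := ‖vτ - uτ‖ ^ 2 + 4 * |M - N| ^ 2 * (∫ s in τ..t, normV (toV (u s)) ^ 2)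
      + ∫ s in τ..t, ‖g s‖ ^ 2) ht.1 (rate_pos hμ).le
    (intervalIntegrable_of_integrableOn_Ioc (hu.integrableOn_norm_sub_sq hv) ht.1 ht.2)
    fun s hs => by
      refine (hu.norm_sub_sq_le_add_integral hv hτT hg hK hβ₁ hβ₃ hμ hα hM hN
        ⟨hs.1, hs.2.trans ht.2⟩).trans ?_
      have hgrad := integral_le_integral_of_nonneg hu.integrableOn_normV_sq
        (fun _ => sq_nonneg _) hs.1 hs.2 ht.2
      have hforcing := integral_le_integral_of_nonneg (hg.1.integrable_norm_pow two_ne_zero)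
        (fun _ => sq_nonneg _) hs.1 hs.2 ht.2
      gcongr
  calc ‖v t - u t‖ ^ 2 ≤ _ := hgronwall
    _ ≤ 4 * (‖vτ - uτ‖ ^ 2 + (∫ s in τ..t, normV (toV (u s)) ^ 2) * |M - N| ^ 2
        + ∫ s in τ..t, ‖g s‖ ^ 2) * Real.exp (rate K μ α M N * (t - τ)) := by
        gcongr
        linarith [sq_nonneg ‖vτ - uτ‖]
    _ = _ := by ring

theorem norm_sub_sq_le_of_lt_one (hu : IsWeakSolution μ α β N τ T fu uτ u)
    (hv : IsWeakSolution μ α β M τ T fv vτ v) (hτT : τ < T) (hg : ForcingDiff τ T fu fv g)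
    (hK : IsSobolevConst Ω K) (hβ₁ : 1 ≤ β) (hβ₃ : β ≤ 3) (hμ : 0 < μ) (hα : 0 ≤ α) (hM : 0 < M)
    (hN : 0 < N) {δ : ℝ} (hδ : δ ≤ 1) (hMN : |M - N| ≤ δ) (huvτ : ‖vτ - uτ‖ ≤ δ)
    (hgδ : ∫ s in τ..T, ‖g s‖ ^ 2 ≤ δ) {t : ℝ} (ht : t ∈ Icc τ T) :
    ‖v t - u t‖ ^ 2 ≤ 4 * Real.exp (rate K μ α (N + 1) N * (T - τ)) *
      (2 + ∫ s in τ..T, normV (toV (u s)) ^ 2) * δ := by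
  have hsq {x : ℝ} (hx : 0 ≤ x) (hxδ : x ≤ δ) : x ^ 2 ≤ δ :=
    (pow_le_of_le_one hx (hxδ.trans hδ) two_ne_zero).trans hxδ
  have hforcing : ∫ s in τ..t, ‖g s‖ ^ 2 ≤ δ :=
    (integral_le_integral_of_nonneg (hg.1.integrable_norm_pow two_ne_zero)
      (fun _ => sq_nonneg _) ht.1 ht.2 le_rfl).trans hgδ
  have hforcing_nonneg : 0 ≤ ∫ s in τ..t, ‖g s‖ ^ 2 :=
    intervalIntegral.integral_nonneg ht.1 fun _ _ => sq_nonneg _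
  have hgrad_nonneg : 0 ≤ ∫ s in τ..t, normV (toV (u s)) ^ 2 :=
    intervalIntegral.integral_nonneg ht.1 fun _ _ => sq_nonneg _
  have hgrad := integral_le_integral_of_nonneg hu.integrableOn_normV_sq (fun _ => sq_nonneg _)
    ht.1 ht.2 le_rfl
  calc ‖v t - u t‖ ^ 2 ≤ 4 * Real.exp (rate K μ α M N * (t - τ)) *
        (‖vτ - uτ‖ ^ 2 + (∫ s in τ..t, normV (toV (u s)) ^ 2) * |M - N| ^ 2
          + ∫ s in τ..t, ‖g s‖ ^ 2) := hu.norm_sub_sq_le hv hτT hg hK hβ₁ hβ₃ hμ hα hM hN ht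
    _ ≤ 4 * Real.exp (rate K μ α (N + 1) N * (T - τ)) *
        (δ + (∫ s in τ..T, normV (toV (u s)) ^ 2) * δ + δ) := by
        gcongr
        · exact sub_nonneg.2 ht.1
        · exact (rate_pos hμ).le
        · exact rate_mono_left hμ hM.le hN.le (by linarith [le_abs_self (M - N)])
        · exact ht.2
        · exact hsq (norm_nonneg _) huvτ
        · exact hgrad_nonneg.trans hgrad
        · exact hsq (abs_nonneg _) hMN
    _ = _ := by ring

theorem exists_forall_norm_sub_lt (hu : IsWeakSolution μ α β N τ T fu uτ u) (hτT : τ < T)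
    (hK : IsSobolevConst Ω K) (hβ₁ : 1 ≤ β) (hβ₃ : β ≤ 3) (hμ : 0 < μ) (hα : 0 ≤ α) (hN : 0 < N)
    {ε : ℝ} (hε : 0 < ε) :
    ∃ δ : ℝ, 0 < δ ∧ ∀ M : ℝ, 0 < M → |M - N| < δ →
      ∀ (fv : ℝ → VDual Ω) (g : ℝ → H Ω), ForcingDiff τ T fu fv g →
        (∫ s in τ..T, ‖g s‖ ^ 2) < δ →
      ∀ (vτ : H Ω) (v : ℝ → H Ω), ‖vτ - uτ‖ < δ → IsWeakSolution μ α β M τ T fv vτ v →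
        ∀ t ∈ Icc τ T, ‖v t - u t‖ < ε := by
  set C := 4 * Real.exp (rate K μ α (N + 1) N * (T - τ)) *
    (2 + ∫ s in τ..T, normV (toV (u s)) ^ 2)
  have hC : 0 < C := by
    have : 0 ≤ ∫ s in τ..T, normV (toV (u s)) ^ 2 :=
      intervalIntegral.integral_nonneg hτT.le fun _ _ => sq_nonneg _
    positivity
  refine ⟨min 1 (ε ^ 2 / (2 * C)), by positivity, fun M hM hMN fv g hg hgδ vτ v hδ hv t ht => ?_⟩
  refine lt_of_pow_lt_pow_left₀ 2 hε.le ?_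
  calc ‖v t - u t‖ ^ 2 ≤ C * min 1 (ε ^ 2 / (2 * C)) :=
        hu.norm_sub_sq_le_of_lt_one hv hτT hg hK hβ₁ hβ₃ hμ hα hM hN (min_le_left _ _) hMN.le hδ.le
          hgδ.le ht
    _ ≤ C * (ε ^ 2 / (2 * C)) := by gcongr; exact min_le_right _ _
    _ = ε ^ 2 / 2 := by field_simp
    _ < ε ^ 2 := half_lt_self (by positivity)

end IsWeakSolution

end Dependence

end GMNSED

theorem mainTheorem9_general (Ω : Set GMNSED.E3) (hΩ : volume Ω ≠ ⊤) (μ α β : ℝ) (hμ : 0 < μ)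
    (hα : 0 ≤ α) (hβ₁ : 1 ≤ β) (hβ₃ : β ≤ 3) :
    (∃ C : ℝ, 0 < C ∧ ∃ γ : ℝ → ℝ → ℝ, (∀ M N : ℝ, 0 < M → 0 < N → 0 < γ M N) ∧
      ∀ (M N : ℝ), 0 < M → 0 < N → ∀ (τ T : ℝ), τ < T →
      ∀ (fu fv : ℝ → GMNSED.VDual Ω) (g : ℝ → GMNSED.H Ω), GMNSED.ForcingDiff τ T fu fv g →
      ∀ (uτ vτ : GMNSED.H Ω) (u v : ℝ → GMNSED.H Ω),
        GMNSED.IsWeakSolution μ α β N τ T fu uτ u →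
        GMNSED.IsWeakSolution μ α β M τ T fv vτ v →
        ∀ t ∈ Set.Icc τ T,
          ‖v t - u t‖ ^ 2 ≤ C * Real.exp (γ M N * (t - τ)) *
            (‖vτ - uτ‖ ^ 2
              + (∫ s in τ..t, GMNSED.normV (GMNSED.toV (u s)) ^ 2) * |M - N| ^ 2
              + ∫ s in τ..t, ‖g s‖ ^ 2)) ∧
    (∀ (N : ℝ), 0 < N → ∀ (τ T : ℝ), τ < T →
      ∀ (fu : ℝ → GMNSED.VDual Ω) (uτ : GMNSED.H Ω) (u : ℝ → GMNSED.H Ω),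
        GMNSED.IsWeakSolution μ α β N τ T fu uτ u →
        ∀ ε : ℝ, 0 < ε → ∃ δ : ℝ, 0 < δ ∧
          ∀ (M : ℝ), 0 < M → |M - N| < δ →
          ∀ (fv : ℝ → GMNSED.VDual Ω) (g : ℝ → GMNSED.H Ω), GMNSED.ForcingDiff τ T fu fv g →
            (∫ s in τ..T, ‖g s‖ ^ 2) < δ →
          ∀ (vτ : GMNSED.H Ω) (v : ℝ → GMNSED.H Ω), ‖vτ - uτ‖ < δ →
            GMNSED.IsWeakSolution μ α β M τ T fv vτ v →
            ∀ t ∈ Set.Icc τ T, ‖v t - u t‖ < ε) := by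
  obtain ⟨K, hK⟩ := GMNSED.exists_isSobolevConst hΩ
  refine ⟨⟨4, by norm_num, GMNSED.rate K μ α, fun M N _ _ => GMNSED.rate_pos hμ, ?_⟩, ?_⟩
  · intro M N hM hN τ T hτT fu fv g hg uτ vτ u v hu hv t ht
    exact hu.norm_sub_sq_le hv hτT hg hK hβ₁ hβ₃ hμ hα hM hN ht
  · intro N hN τ T hτT fu uτ u hu ε hε
    exact hu.exists_forall_norm_sub_lt hτT hK hβ₁ hβ₃ hμ hα hN hε

theorem mainTheorem9 (Ω : Set GMNSED.E3) (hΩ_open : IsOpen Ω) (hΩ_bdd : Bornology.IsBounded Ω)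
    (μ α β : ℝ) (hμ : 0 < μ) (hα : 0 < α) (hβ₁ : 1 ≤ β) (hβ₃ : β ≤ 3) :
    -- the estimate, with `C` and `γ` depending only on `Ω, μ, α, β` (and `γ` on `M, N`)
    (∃ C : ℝ, 0 < C ∧ ∃ γ : ℝ → ℝ → ℝ, (∀ M N : ℝ, 0 < M → 0 < N → 0 < γ M N) ∧
      ∀ (M N : ℝ), 0 < M → 0 < N → ∀ (τ T : ℝ), τ < T →
      ∀ (fu fv : ℝ → GMNSED.VDual Ω) (g : ℝ → GMNSED.H Ω), GMNSED.ForcingDiff τ T fu fv g →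
      ∀ (uτ vτ : GMNSED.H Ω) (u v : ℝ → GMNSED.H Ω),
        GMNSED.IsWeakSolution μ α β N τ T fu uτ u →
        GMNSED.IsWeakSolution μ α β M τ T fv vτ v →
        ∀ t ∈ Set.Icc τ T,
          ‖v t - u t‖ ^ 2 ≤ C * Real.exp (γ M N * (t - τ)) *
            (‖vτ - uτ‖ ^ 2
              + (∫ s in τ..t, GMNSED.normV (GMNSED.toV (u s)) ^ 2) * |M - N| ^ 2
              + ∫ s in τ..t, ‖g s‖ ^ 2)) ∧
    -- continuous dependence on the cutoff, the initial datum and the forcing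
    (∀ (N : ℝ), 0 < N → ∀ (τ T : ℝ), τ < T →
      ∀ (fu : ℝ → GMNSED.VDual Ω) (uτ : GMNSED.H Ω) (u : ℝ → GMNSED.H Ω),
        GMNSED.IsWeakSolution μ α β N τ T fu uτ u →
        ∀ ε : ℝ, 0 < ε → ∃ δ : ℝ, 0 < δ ∧
          ∀ (M : ℝ), 0 < M → |M - N| < δ →
          ∀ (fv : ℝ → GMNSED.VDual Ω) (g : ℝ → GMNSED.H Ω), GMNSED.ForcingDiff τ T fu fv g →
            (∫ s in τ..T, ‖g s‖ ^ 2) < δ →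
          ∀ (vτ : GMNSED.H Ω) (v : ℝ → GMNSED.H Ω), ‖vτ - uτ‖ < δ →
            GMNSED.IsWeakSolution μ α β M τ T fv vτ v →
            ∀ t ∈ Set.Icc τ T, ‖v t - u t‖ < ε) :=
  mainTheorem9_general Ω hΩ_bdd.measure_lt_top.ne μ α β hμ hα.le hβ₁ hβ₃
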